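/- Let $S,A,B$ be finite sets ($A,B$ non-empty), $g:S\times A\times B\to\mathbb R$, $r>0$, and let $R=(\rho_{ss'})_{s,s'\in S}$ be the generator of a continuous-time Markov chain $(s_t)_{t\ge 0}$ on $S$ ($\rho_{ss'}\ge 0$ for $s\ne s'$, rows summing to $0$), with transition semigroup $P_t=\exp(tR)$. For $n\ge 1$ and $p\in\Delta(S)$ let $G_n(p)$ be the following zero-sum game. The chain has initial law $p$. At each stage $k=0,1,2,\dots$ player 1, knowing $s_0,s_{1/n},\dots,s_{k/n}$ and his own past actions, chooses $a_k\in A$, and simultaneously player 2, knowing only the past actions of player 1 and his own past actions, chooses $b_k\in B$; both may randomize (behaviour strategies). Player 1 maximizes, and player 2 minimizes, the discounted payoff $$\sum_{k\ge 0}\lambda_n(1-\lambda_n)^k\,\mathbf E\big[g(s_{k/n},a_k,b_k)\big],\qquad \lambda_n=1-e^{-r/n}.$$ For $p\in\Delta(S)$ let $$u(p)=\max_{x\in\Delta(A)}\min_{y\in\Delta(B)}\sum_{s,a,b}p(s)x(a)y(b)g(s,a,b),$$ let $p^*_t={}^T\!P_t\,p$, and let $\delta_s\in\Delta(S)$ be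 the unit mass at $s$. Say that $v:\Delta(S)\to\mathbb R$ is the limit value if every game $G_n(p)$ ($n\ge1$, $p\in\Delta(S)$) has a value $\tilde v_n(p)$ (that is, $\sup\inf=\inf\sup=\tilde v_n(p)$) and $\tilde v_n\to v$ uniformly on $\Delta(S)$ as $n\to\infty$. (1) If $u$ is concave on $\Delta(S)$, then the limit value exists and, for every $p\in\Delta(S)$, $$v(p)=\int_0^\infty re^{-rt}u(p^*_t)\,dt.$$ (2) If $u$ is convex on $\Delta(S)$, then the limit value exists and, for every $p\in\Delta(S)$, $$v(p)=\sum_{s\in S}u(\delta_s)\int_0^\infty re^{-rt}p^*_t(s)\,dt.$$ -/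

import Mathlib

open Filter Topology

noncomputable section

namespace MarkovGame

/-- `R` is the generator of a continuous-time Markov chain on the finite state space `S`. -/
structure IsGenerator {S : Type*} [Fintype S] (R : Matrix S S ℝ) : Prop where
  rate_nonneg : ∀ s s', s ≠ s' → 0 ≤ R s s'
  row_sum : ∀ s, ∑ s', R s s' = 0

/-- The transition semigroup `P_t = exp (t R)`. -/
def semigroup {S : Type*} [Fintype S] [DecidableEq S] (R : Matrix S S ℝ) (t : ℝ) :
    Matrix S S ℝ :=
  NormedSpace.exp (t • R)

/-- `p*_t = ᵀP_t p`, the law of the state at time `t` when the initial law is `p`. -/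
def beliefFlow {S : Type*} [Fintype S] [DecidableEq S] (R : Matrix S S ℝ) (p : S → ℝ) (t : ℝ) :
    S → ℝ :=
  Matrix.mulVec (semigroup R t).transpose p

/-- The `sup inf` (lower) value of a zero-sum game in normal form; player 1 maximizes. -/
def lowerValue {X Y : Type*} (f : X → Y → ℝ) : ℝ := ⨆ x, ⨅ y, f x y

/-- The `inf sup` (upper) value of a zero-sum game in normal form. -/
def upperValue {X Y : Type*} (f : X → Y → ℝ) : ℝ := ⨅ y, ⨆ x, f x y

/-- `w` is the value of the zero-sum game with payoff `f`. -/
def IsValue {X Y : Type*} (f : X → Y → ℝ) (w : ℝ) : Prop :=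
  lowerValue f = w ∧ upperValue f = w

/-- Expected payoff `g(p, x, y)` of the one-shot average game `Γ(p)` under mixed actions. -/
def oneShotPayoff {S A B : Type*} [Fintype S] [Fintype A] [Fintype B] (g : S → A → B → ℝ)
    (p : S → ℝ) (x : stdSimplex ℝ A) (y : stdSimplex ℝ B) : ℝ :=
  ∑ a, ∑ b, (x : A → ℝ) a * (y : B → ℝ) b * ∑ s, p s * g s a b

/-- `u(p) = max_x min_y g(p, x, y)`, the value of the one-shot average game `Γ(p)`. -/
def oneShotValue {S A B : Type*} [Fintype S] [Fintype A] [Fintype B] (g : S → A → B → ℝ)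
    (p : S → ℝ) : ℝ :=
  lowerValue (oneShotPayoff g p)

/-- Behaviour strategies of player 1: the mixed action at stage `k` depends on the states
`s_0, …, s_k` and on his own past actions `a_0, …, a_{k-1}`. -/
abbrev Strategy1 (S A : Type*) [Fintype A] : Type _ :=
  (k : ℕ) → (Fin (k + 1) → S) → (Fin k → A) → stdSimplex ℝ A

/-- Behaviour strategies of player 2: the mixed action at stage `k` depends on the past actions
`(a_0, b_0), …, (a_{k-1}, b_{k-1})` of player 1 (observed) and of player 2 (recalled), and not on
the states. -/
abbrev Strategy2 (A B : Type*) [Fintype B] : Type _ :=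
  (k : ℕ) → (Fin k → A × B) → stdSimplex ℝ B

/-- Probability of the play `(s_i, a_i, b_i)_{0 ≤ i ≤ k}` of stages `0, …, k`, when `s` is a Markov
chain with initial law `p` and transition matrix `Q`, and the players use `σ` and `τ`. -/
def playProb {S A B : Type*} [Fintype A] [Fintype B]
    (Q : Matrix S S ℝ) (p : S → ℝ) (σ : Strategy1 S A) (τ : Strategy2 A B)
    (k : ℕ) (h : Fin (k + 1) → S × A × B) : ℝ :=
  p (h 0).1 *
    (∏ i : Fin k, Q (h i.castSucc).1 (h i.succ).1) *
    ∏ i : Fin (k + 1),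
      ((σ i (fun j => (h (j.castLE (Nat.succ_le_of_lt i.isLt))).1)
          (fun j => (h (j.castLE i.isLt.le)).2.1) : A → ℝ) (h i).2.1 *
        (τ i (fun j => (h (j.castLE i.isLt.le)).2) : B → ℝ) (h i).2.2)

/-- Expected payoff of stage `k`. -/
def stagePayoff {S A B : Type*} [Fintype S] [Fintype A] [Fintype B] (g : S → A → B → ℝ)
    (Q : Matrix S S ℝ) (p : S → ℝ) (σ : Strategy1 S A) (τ : Strategy2 A B) (k : ℕ) : ℝ :=
  ∑ h : Fin (k + 1) → S × A × B,
    playProb Q p σ τ k h *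
      g (h (Fin.last k)).1 (h (Fin.last k)).2.1 (h (Fin.last k)).2.2

/-- `λ_n = 1 - exp (-r / n)`. -/
def stageDiscount (r : ℝ) (n : ℕ) : ℝ := 1 - Real.exp (-r / n)

/-- Payoff `∑_k λ_n (1 - λ_n)^k E[g(s_{k/n}, a_k, b_k)]` of the game `G_n(p)`. The states
`s_{k/n}` form a Markov chain with initial law `p` and transition matrix `P_{1/n}`. -/
def gamePayoff {S A B : Type*} [Fintype S] [DecidableEq S] [Fintype A] [Fintype B]
    (g : S → A → B → ℝ) (R : Matrix S S ℝ) (r : ℝ) (n : ℕ) (p : S → ℝ)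
    (σ : Strategy1 S A) (τ : Strategy2 A B) : ℝ :=
  ∑' k : ℕ, stageDiscount r n * (1 - stageDiscount r n) ^ k *
    stagePayoff g (semigroup R (1 / (n : ℝ))) p σ τ k

/-- `v` is the limit value on `Δ(S)`: every game `G_n(p)` with `n ≥ 1` and `p ∈ Δ(S)` has a value
`w n p`, and these values converge to `v p`, uniformly on `Δ(S)`. -/
def IsLimitValue {S A B : Type*} [Fintype S] [DecidableEq S] [Fintype A] [Fintype B]
    (g : S → A → B → ℝ) (R : Matrix S S ℝ) (r : ℝ) (v : (S → ℝ) → ℝ) : Prop :=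
  ∃ w : ℕ → (S → ℝ) → ℝ,
    (∀ n, 1 ≤ n → ∀ p ∈ stdSimplex ℝ S, IsValue (gamePayoff g R r n p) (w n p)) ∧
      TendstoUniformlyOn w v atTop (stdSimplex ℝ S)

end MarkovGame

end

/-! Both cases are instances of one statement, `isLimitValue_of_concave_majorant`. Let `f` be a
concave Lipschitz majorant of `u` such that player 1 guarantees, at every stage and up to any error,
`f` of the current law of the state. Then the limit value is the discounted integral of `f` along
the flow of laws. If `u` is concave, `f = u` and player 1 ignores the state. If `u` is convex, `f`
interpolates the vertex values of `u` linearly and player 1 plays optimally given the current state.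

The upper bound is `lowerValue_gamePayoff_le`. Knowing player 1's strategy, player 2 tracks the
belief on the state given player 1's past actions, and replies to the average mixed action in the
average game at that belief. The correlation between action and state costs at most a constant times
the expected L1 variation of the belief caused by the action. By |d| ≤ δ + d²/(4δ), this is
controlled by the mean squared variation, which is the increment of the expected squared norm of the
belief (`energy`). That quantity stays in [0, 1], so its discounted increments sum to at most λ_n,
while each transition of the chain destroys at most 2 `drift` of it. For fixed δ both terms vanish
as n → ∞, leaving O(δ). Beliefs average to the law of the state, so Jensen's inequality replaces `f`
at the beliefs by `f` at the law.

This reply depends on player 1's strategy and hence bounds only sup inf. That suffices because a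
minimax theorem gives every game a value: payoffs are affine in realization weights and player 1's
strategies form a compact space. Finally λ_n(1-λ_n)^k is the exact integral of r e^{-rt} over [k/n,
(k+1)/n], so sum and integral differ only by the oscillation of `f` along the flow. All errors are
uniform in p. -/

noncomputable section

namespace MarkovGame

/-! ### Minimax theorem for convexlike payoffs, and values of bounded games -/

section Minimax

variable {X Y : Type*}

/-- A convexlike function on `Y` satisfies the finite form of convexlikeness. -/
theorem exists_le_weighted_sum {ι : Type*} (f : X → Y → ℝ)
    (hY : ∀ y₀ y₁ : Y, ∀ t : ℝ, 0 ≤ t → t ≤ 1 →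
      ∃ y, ∀ x, f x y ≤ (1 - t) * f x y₀ + t * f x y₁)
    (y : ι → Y) (w : ι → ℝ) (hw : ∀ i, 0 ≤ w i) (s : Finset ι) (hs : 0 < ∑ i ∈ s, w i) :
    ∃ z, ∀ x, (∑ i ∈ s, w i) * f x z ≤ ∑ i ∈ s, w i * f x (y i) := by
  classical
  induction s using Finset.induction_on with
  | empty => simp at hs
  | insert a s ha ih =>
    rw [Finset.sum_insert ha] at hs
    simp only [Finset.sum_insert ha]
    rcases (Finset.sum_nonneg fun i (_ : i ∈ s) => hw i).eq_or_lt with h0 | h0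
    · have hz := (Finset.sum_eq_zero_iff_of_nonneg fun i _ => hw i).1 h0.symm
      refine ⟨y a, fun x => ?_⟩
      rw [← h0, Finset.sum_eq_zero fun i hi => by rw [hz i hi, zero_mul]]
      simp
    · obtain ⟨z, hz⟩ := ih h0
      set W := ∑ i ∈ s, w i with hW
      have hwa := hw a
      obtain ⟨z', hz'⟩ := hY (y a) z (W / (w a + W)) (by positivity)
        ((div_le_one hs).2 (by linarith))
      refine ⟨z', fun x => ?_⟩
      have h1 := mul_le_mul_of_nonneg_left (hz' x) hs.le
      have h2 : (w a + W) * ((1 - W / (w a + W)) * f x (y a) + W / (w a + W) * f x z) =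
          w a * f x (y a) + W * f x z := by
        field_simp
        ring
      linarith [hz x]

/-- **Minimax theorem** for payoffs that are concavelike in the first variable, which ranges over
a compact space, and convexlike in the second one. -/
theorem exists_forall_le_of_convexlike [TopologicalSpace X] [CompactSpace X] [Nonempty X]
    (f : X → Y → ℝ) (hf : ∀ y, Continuous fun x => f x y)
    (hX : ∀ x₀ x₁ : X, ∀ t : ℝ, 0 ≤ t → t ≤ 1 →
      ∃ x, ∀ y, (1 - t) * f x₀ y + t * f x₁ y ≤ f x y)
    (hY : ∀ y₀ y₁ : Y, ∀ t : ℝ, 0 ≤ t → t ≤ 1 →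
      ∃ y, ∀ x, f x y ≤ (1 - t) * f x y₀ + t * f x y₁)
    (c : ℝ) (hc : ∀ x, ∃ y, f x y < c) : ∃ y, ∀ x, f x y ≤ c := by
  classical
  -- Compactness leaves finitely many `y` in play, so the separation takes place in a
  -- finite-dimensional space.
  obtain ⟨T, hT⟩ := isCompact_univ.elim_finite_subcover (fun y => {x | f x y < c})
    (fun y => isOpen_lt (hf y) continuous_const)
    (fun x _ => Set.mem_iUnion.2 (hc x))
  -- Taking everything below the payoff vectors makes `D` convex, although concavelikeness is only
  -- an inequality. `D` misses the open positive orthant `P` because each `x` has some `y` in `T`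
  -- with `f x y < c`.
  let D : Set (T → ℝ) := {z | ∃ x, ∀ i : T, z i ≤ f x i - c}
  let P : Set (T → ℝ) := Set.univ.pi fun _ => Set.Ioi 0
  have hPo : IsOpen P := isOpen_set_pi Set.finite_univ fun _ _ => isOpen_Ioi
  have hPc : Convex ℝ P := convex_pi fun _ _ => convex_Ioi 0
  have hDc : Convex ℝ D := by
    rintro z₀ ⟨x₀, h₀⟩ z₁ ⟨x₁, h₁⟩ a b ha hb hab
    obtain ⟨x, hx⟩ := hX x₀ x₁ b hb (by linarith)
    refine ⟨x, fun i => ?_⟩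
    have ha' : a = 1 - b := by linarith
    subst ha'
    have h2 := mul_le_mul_of_nonneg_left (h₀ i) ha
    have h3 := mul_le_mul_of_nonneg_left (h₁ i) hb
    simp only [Pi.add_apply, Pi.smul_apply, smul_eq_mul]
    linarith [hx i]
  have hdisj : Disjoint P D := by
    rw [Set.disjoint_left]
    rintro z hz ⟨x, hx⟩
    obtain ⟨y, hyT, hy⟩ := Set.mem_iUnion₂.1 (hT (Set.mem_univ x))
    have h1 := hx ⟨y, hyT⟩
    have h2 : 0 < z ⟨y, hyT⟩ := hz ⟨y, hyT⟩ trivial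
    have h3 : f x y < c := hy
    simp only at h1
    linarith
  obtain ⟨φ, u, hφP, hφD⟩ := geometric_hahn_banach_open hPc hPo hDc hdisj
  have hφ : ∀ z : T → ℝ, φ z = ∑ i, z i * φ (Pi.single i 1) := by
    intro z
    conv_lhs => rw [pi_eq_sum_univ' z, map_sum]
    refine Finset.sum_congr rfl fun i _ => ?_
    rw [map_smul, smul_eq_mul]
  have hu : 0 ≤ u := by
    have h1 : Tendsto (fun ε : ℝ => φ (ε • (1 : T → ℝ))) (𝓝[>] 0) (𝓝 0) := by
      have : Continuous fun ε : ℝ => φ (ε • (1 : T → ℝ)) := by fun_prop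
      simpa using (this.tendsto 0).mono_left nhdsWithin_le_nhds
    refine le_of_tendsto h1 ?_
    filter_upwards [self_mem_nhdsWithin] with ε hε
    exact (hφP _ fun i _ => by simpa using hε).le
  -- `φ` is bounded above by `u` on `P`, which is unbounded in every coordinate direction. The
  -- numbers `-φ (Pi.single i 1)` thus serve as the weights of a mixed action of player 2.
  have hneg : ∀ i, φ (Pi.single i 1) ≤ 0 := by
    intro i
    by_contra! hpos
    have h1 : Tendsto (fun N : ℝ => N * φ (Pi.single i 1) + φ 1) atTop atTop :=
      tendsto_atTop_add_const_right _ _ (tendsto_id.atTop_mul_const hpos)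
    obtain ⟨N, hN0, hN⟩ := ((eventually_ge_atTop (0 : ℝ)).and (h1.eventually_ge_atTop u)).exists
    have h2 : N • Pi.single i (1 : ℝ) + (1 : T → ℝ) ∈ P := by
      intro j _
      by_cases hj : j = i
      · subst hj
        simp only [Pi.add_apply, Pi.smul_apply, Pi.single_eq_same, smul_eq_mul, mul_one,
          Pi.one_apply, Set.mem_Ioi]
        linarith
      · simp [hj]
    have h3 := hφP _ h2
    rw [map_add, map_smul, smul_eq_mul] at h3
    linarith
  obtain ⟨x₀⟩ := ‹Nonempty X›
  -- If all weights vanished, `φ` would be zero, giving both `0 < u` on `P` and `u ≤ 0` on `D`.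
  have hΛ : 0 < ∑ i : T, -φ (Pi.single i 1) := by
    refine (Finset.sum_nonneg fun i _ => neg_nonneg.2 (hneg i)).lt_of_ne fun h0 => ?_
    have hz := (Finset.sum_eq_zero_iff_of_nonneg fun i _ => neg_nonneg.2 (hneg i)).1 h0.symm
    have hφ0 : ∀ z, φ z = 0 := fun z => by
      rw [hφ]
      refine Finset.sum_eq_zero fun i hi => ?_
      rw [neg_eq_zero.1 (hz i hi), mul_zero]
    have h1 := hφP 1 fun i _ => by simp
    have h2 := hφD (fun i => f x₀ i - c) ⟨x₀, fun i => le_rfl⟩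
    rw [hφ0] at h1 h2
    linarith
  obtain ⟨z, hz⟩ := exists_le_weighted_sum f hY (fun i : T => (i : Y))
    (fun i => -φ (Pi.single i 1)) (fun i => neg_nonneg.2 (hneg i)) Finset.univ hΛ
  refine ⟨z, fun x => ?_⟩
  have h1 := hφD (fun i => f x i - c) ⟨x, fun i => le_rfl⟩
  rw [hφ] at h1
  have h2 : ∑ i : T, -φ (Pi.single i 1) * f x i =
      -(∑ i : T, (f x i - c) * φ (Pi.single i 1)) + (∑ i : T, -φ (Pi.single i 1)) * c := by
    rw [Finset.sum_mul, ← Finset.sum_neg_distrib, ← Finset.sum_add_distrib]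
    exact Finset.sum_congr rfl fun i _ => by ring
  have h3 := hz x
  rw [h2] at h3
  exact le_of_mul_le_mul_left (by linarith) hΛ

variable {f : X → Y → ℝ} {M : ℝ}

theorem bddBelow_range_right (hM : ∀ x y, |f x y| ≤ M) (x : X) :
    BddBelow (Set.range fun y => f x y) :=
  ⟨-M, by rintro _ ⟨y, rfl⟩; exact (abs_le.1 (hM x y)).1⟩

theorem bddAbove_range_left (hM : ∀ x y, |f x y| ≤ M) (y : Y) :
    BddAbove (Set.range fun x => f x y) :=
  ⟨M, by rintro _ ⟨x, rfl⟩; exact (abs_le.1 (hM x y)).2⟩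

theorem bddAbove_range_iInf [Nonempty Y] (hM : ∀ x y, |f x y| ≤ M) :
    BddAbove (Set.range fun x => ⨅ y, f x y) := by
  refine ⟨M, ?_⟩
  rintro _ ⟨x, rfl⟩
  exact (ciInf_le (bddBelow_range_right hM x) (Classical.arbitrary Y)).trans (abs_le.1 (hM x _)).2

theorem bddBelow_range_iSup [Nonempty X] (hM : ∀ x y, |f x y| ≤ M) :
    BddBelow (Set.range fun y => ⨆ x, f x y) := by
  refine ⟨-M, ?_⟩
  rintro _ ⟨y, rfl⟩
  exact (abs_le.1 (hM _ y)).1.trans (le_ciSup (bddAbove_range_left hM y) (Classical.arbitrary X))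

theorem le_lowerValue [Nonempty Y] (hM : ∀ x y, |f x y| ≤ M) {c : ℝ} (x : X) (hx : ∀ y, c ≤ f x y) :
    c ≤ lowerValue f :=
  (le_ciInf hx).trans (le_ciSup (bddAbove_range_iInf hM) x)

theorem exists_lt_of_lowerValue_lt [Nonempty Y] (hM : ∀ x y, |f x y| ≤ M) {c : ℝ} (hc : lowerValue f < c)
    (x : X) : ∃ y, f x y < c :=
  exists_lt_of_ciInf_lt ((le_ciSup (bddAbove_range_iInf hM) x).trans_lt hc)

theorem lowerValue_le [Nonempty X] (hM : ∀ x y, |f x y| ≤ M) {c : ℝ} (h : ∀ x, ∃ y, f x y ≤ c) :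
    lowerValue f ≤ c :=
  ciSup_le fun x => let ⟨y, hy⟩ := h x; (ciInf_le (bddBelow_range_right hM x) y).trans hy

theorem exists_forall_lt_of_lt_lowerValue [Nonempty X] (hM : ∀ x y, |f x y| ≤ M) {c : ℝ}
    (hc : c < lowerValue f) : ∃ x, ∀ y, c < f x y := by
  obtain ⟨x, hx⟩ := exists_lt_of_lt_ciSup hc
  exact ⟨x, fun y => hx.trans_le (ciInf_le (bddBelow_range_right hM x) y)⟩

theorem isValue_lowerValue [Nonempty X] [Nonempty Y] (hM : ∀ x y, |f x y| ≤ M)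
    (h : ∀ c, (∀ x, ∃ y, f x y < c) → ∃ y, ∀ x, f x y ≤ c) : IsValue f (lowerValue f) := by
  refine ⟨rfl, le_antisymm ?_ ?_⟩
  · refine le_of_forall_gt_imp_ge_of_dense fun c hc => ?_
    obtain ⟨y, hy⟩ := h c (exists_lt_of_lowerValue_lt hM hc)
    exact (ciInf_le (bddBelow_range_iSup hM) y).trans (ciSup_le hy)
  · exact ciSup_le fun x => le_ciInf fun y =>
      (ciInf_le (bddBelow_range_right hM x) y).trans (le_ciSup (bddAbove_range_left hM y) x)

end Minimax

/-! ### The transition semigroup, the flow of laws and its modulus of continuity -/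

section Semigroup

variable {S : Type*} [Fintype S] [DecidableEq S]

open scoped Matrix.Norms.Operator in
theorem continuous_semigroup (R : Matrix S S ℝ) : Continuous (semigroup R) :=
  NormedSpace.exp_continuous.comp (continuous_id.smul continuous_const)

theorem semigroup_zero (R : Matrix S S ℝ) : semigroup R 0 = 1 := by
  simp [semigroup]

theorem semigroup_add (R : Matrix S S ℝ) (s t : ℝ) :
    semigroup R (s + t) = semigroup R s * semigroup R t := by
  rw [semigroup, add_smul]
  exact Matrix.exp_add_of_commute _ _ (((Commute.refl R).smul_left s).smul_right t)

open scoped Matrix.Norms.Operator in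
theorem exp_nonneg_of_nonneg {N : Matrix S S ℝ} (hN : ∀ s s', 0 ≤ N s s') (s s' : S) :
    0 ≤ NormedSpace.exp N s s' := by
  have h1 := NormedSpace.exp_series_hasSum_exp' (𝕂 := ℝ) N
  have h2 : HasSum (fun n : ℕ => (((n.factorial : ℝ)⁻¹ • N ^ n : Matrix S S ℝ)) s s')
      (NormedSpace.exp N s s') :=
    h1.map (Matrix.entryAddMonoidHom ℝ s s') (continuous_apply_apply s s')
  refine h2.nonneg fun n => ?_
  have h3 : ∀ n : ℕ, ∀ s s', 0 ≤ (N ^ n) s s' := by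
    intro n
    induction n with
    | zero =>
      intro s s'
      rw [pow_zero, Matrix.one_apply]
      split_ifs <;> norm_num
    | succ n ih =>
      intro s s'
      rw [pow_succ, Matrix.mul_apply]
      exact Finset.sum_nonneg fun j _ => mul_nonneg (ih s j) (hN j s')
  rw [Matrix.smul_apply, smul_eq_mul]
  exact mul_nonneg (by positivity) (h3 n s s')

/-- Uniformization: adding a large multiple `c` of the identity makes the generator entrywise
nonnegative, and only multiplies the exponential by the positive scalar exp(tc). -/
theorem semigroup_nonneg {R : Matrix S S ℝ} (hR : IsGenerator R) {t : ℝ} (ht : 0 ≤ t) (s s' : S) :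
    0 ≤ semigroup R t s s' := by
  set c : ℝ := ∑ j, |R j j| with hc
  have h1 : t • R = (-(t * c)) • (1 : Matrix S S ℝ) + t • (R + c • (1 : Matrix S S ℝ)) := by
    rw [smul_add, smul_smul, neg_smul]
    abel
  rw [semigroup, h1, Matrix.exp_add_of_commute _ _ ((Commute.one_left _).smul_left _),
    Matrix.smul_one_eq_diagonal, Matrix.exp_diagonal, Matrix.diagonal_mul]
  refine mul_nonneg ?_ (exp_nonneg_of_nonneg (fun i j => ?_) s s')
  · rw [Pi.coe_exp, ← Real.exp_eq_exp_ℝ]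
    exact (Real.exp_pos _).le
  · rw [Matrix.smul_apply, smul_eq_mul, Matrix.add_apply, Matrix.smul_apply, smul_eq_mul]
    refine mul_nonneg ht ?_
    by_cases hij : i = j
    · subst hij
      have h2 : |R i i| ≤ c := Finset.single_le_sum (f := fun j => |R j j|)
        (fun j _ => abs_nonneg _) (Finset.mem_univ i)
      have h3 := neg_abs_le (R i i)
      rw [Matrix.one_apply_eq]
      linarith
    · rw [Matrix.one_apply_ne hij, mul_zero, add_zero]
      exact hR.rate_nonneg i j hij

-- Summing a row is continuous and additive, so it passes through the exponential series. Every term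
-- after the first vanishes, since its last factor has zero row sums.
open scoped Matrix.Norms.Operator in
theorem semigroup_row_sum {R : Matrix S S ℝ} (hR : IsGenerator R) (t : ℝ) (s : S) :
    ∑ s', semigroup R t s s' = 1 := by
  have h1 := NormedSpace.exp_series_hasSum_exp' (𝕂 := ℝ) (t • R)
  let rowSum : Matrix S S ℝ →+ ℝ :=
    { toFun := fun N => ∑ s', N s s'
      map_zero' := by simp
      map_add' := fun N N' => by simp [Finset.sum_add_distrib] }
  have h2 : HasSum (fun n : ℕ => rowSum ((n.factorial : ℝ)⁻¹ • (t • R) ^ n))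
      (rowSum (NormedSpace.exp (t • R))) :=
    h1.map rowSum (continuous_finsetSum _ fun s' _ => continuous_apply_apply s s')
  have h3 : HasSum (fun n : ℕ => rowSum ((n.factorial : ℝ)⁻¹ • (t • R) ^ n)) 1 := by
    convert hasSum_ite_eq (0 : ℕ) (1 : ℝ) using 2 with n
    change ∑ s', ((n.factorial : ℝ)⁻¹ • (t • R) ^ n : Matrix S S ℝ) s s' = _
    split_ifs with hn
    · subst hn
      simp [Matrix.one_apply]
    · obtain ⟨m, rfl⟩ := Nat.exists_eq_succ_of_ne_zero hn
      have hpow : ∑ s', ((t • R) ^ (m + 1)) s s' = 0 := by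
        simp only [pow_succ, Matrix.mul_apply]
        rw [Finset.sum_comm]
        simp [← Finset.mul_sum, hR.row_sum]
      change ∑ s', ((m + 1).factorial : ℝ)⁻¹ * ((t • R) ^ (m + 1)) s s' = 0
      rw [← Finset.mul_sum, hpow, mul_zero]
  exact h2.unique h3

theorem beliefFlow_apply (R : Matrix S S ℝ) (p : S → ℝ) (t : ℝ) (s : S) :
    beliefFlow R p t s = ∑ s', p s' * semigroup R t s' s := by
  simp [beliefFlow, Matrix.mulVec, dotProduct, mul_comm]

theorem beliefFlow_mem {R : Matrix S S ℝ} (hR : IsGenerator R) {p : S → ℝ}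
    (hp : p ∈ stdSimplex ℝ S) {t : ℝ} (ht : 0 ≤ t) : beliefFlow R p t ∈ stdSimplex ℝ S := by
  refine ⟨fun s => ?_, ?_⟩
  · rw [beliefFlow_apply]
    exact Finset.sum_nonneg fun s' _ => mul_nonneg (hp.1 s') (semigroup_nonneg hR ht s' s)
  · simp only [beliefFlow_apply]
    rw [Finset.sum_comm]
    simp only [← Finset.mul_sum, semigroup_row_sum hR, mul_one]
    exact hp.2

theorem beliefFlow_zero (R : Matrix S S ℝ) (p : S → ℝ) : beliefFlow R p 0 = p := by
  simp [beliefFlow, semigroup_zero]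

theorem beliefFlow_add (R : Matrix S S ℝ) (p : S → ℝ) (s t : ℝ) :
    beliefFlow R p (s + t) = beliefFlow R (beliefFlow R p s) t := by
  simp [beliefFlow, semigroup_add, Matrix.transpose_mul]

theorem continuous_beliefFlow (R : Matrix S S ℝ) (p : S → ℝ) : Continuous (beliefFlow R p) :=
  (continuous_semigroup R).matrix_transpose.matrix_mulVec continuous_const

/-- The entrywise distance between a transition matrix and the identity. -/
def drift (Q : Matrix S S ℝ) : ℝ := ∑ s, ∑ s', |Q s s' - (1 : Matrix S S ℝ) s s'|

theorem sum_abs_transition_sub_le (Q : Matrix S S ℝ) {p : S → ℝ} (hp : p ∈ stdSimplex ℝ S) :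
    ∑ s, |∑ s', p s' * Q s' s - p s| ≤ drift Q := by
  have h1 : ∀ s, |∑ s', p s' * Q s' s - p s| ≤
      ∑ s', |Q s' s - (1 : Matrix S S ℝ) s' s| := by
    intro s
    have h2 : ∑ s', p s' * Q s' s - p s =
        ∑ s', p s' * (Q s' s - (1 : Matrix S S ℝ) s' s) := by
      simp [mul_sub, Finset.sum_sub_distrib, Matrix.one_apply]
    rw [h2]
    refine (Finset.abs_sum_le_sum_abs _ _).trans (Finset.sum_le_sum fun s' _ => ?_)
    rw [abs_mul, abs_of_nonneg (hp.1 s')]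
    exact mul_le_of_le_one_left (abs_nonneg _)
      ((Finset.single_le_sum (fun j _ => hp.1 j) (Finset.mem_univ s')).trans hp.2.le)
  refine (Finset.sum_le_sum fun s _ => h1 s).trans ?_
  rw [Finset.sum_comm]
  rfl

theorem sum_abs_beliefFlow_sub_le (R : Matrix S S ℝ) {p : S → ℝ} (hp : p ∈ stdSimplex ℝ S)
    (t : ℝ) : ∑ s, |beliefFlow R p t s - p s| ≤ drift (semigroup R t) := by
  simp only [beliefFlow_apply]
  exact sum_abs_transition_sub_le _ hp

theorem continuous_drift_semigroup (R : Matrix S S ℝ) :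
    Continuous fun t => drift (semigroup R t) :=
  continuous_finsetSum _ fun s _ => continuous_finsetSum _ fun s' _ =>
    (((continuous_semigroup R).matrix_elem s s').sub continuous_const).abs

theorem drift_semigroup_zero (R : Matrix S S ℝ) : drift (semigroup R 0) = 0 := by
  simp [drift, semigroup_zero]

end Semigroup

/-! ### Factorization of play probabilities and laws of the states -/

section Weights

variable {S A B : Type*}

/-- Probability that a Markov chain with initial law `p` and transition matrix `Q` starts with the
given states. -/
def chainWeight (Q : Matrix S S ℝ) (p : S → ℝ) : (k : ℕ) → (Fin (k + 1) → S) → ℝ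
  | 0, s => p (s 0)
  | k + 1, s =>
    chainWeight Q p k (Fin.init s) * Q (s (Fin.last k).castSucc) (s (Fin.last (k + 1)))

/-- Contribution of player 1 to the probability of a play. -/
def weight1 [Fintype A] (σ : Strategy1 S A) : (k : ℕ) → (Fin k → S) → (Fin k → A) → ℝ
  | 0, _, _ => 1
  | k + 1, s, a =>
    weight1 σ k (Fin.init s) (Fin.init a) * (σ k s (Fin.init a) : A → ℝ) (a (Fin.last k))

/-- Contribution of player 2 to the probability of a play. -/
def weight2 [Fintype B] (τ : Strategy2 A B) : (k : ℕ) → (Fin k → A × B) → ℝ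
  | 0, _ => 1
  | k + 1, c => weight2 τ k (Fin.init c) * (τ k (Fin.init c) : B → ℝ) (c (Fin.last k)).2

theorem chainWeight_eq_prod (Q : Matrix S S ℝ) (p : S → ℝ) (k : ℕ) (s : Fin (k + 1) → S) :
    chainWeight Q p k s = p (s 0) * ∏ i : Fin k, Q (s i.castSucc) (s i.succ) := by
  induction k with
  | zero => simp [chainWeight]
  | succ k ih =>
    rw [chainWeight, ih, Fin.prod_univ_castSucc, mul_assoc]
    rfl

theorem weight1_eq_prod [Fintype A] (σ : Strategy1 S A) (k : ℕ) (s : Fin k → S) (a : Fin k → A) :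
    weight1 σ k s a = ∏ i : Fin k,
      (σ i (fun j => s (j.castLE (Nat.succ_le_of_lt i.isLt)))
        (fun j => a (j.castLE i.isLt.le)) : A → ℝ) (a i) := by
  induction k with
  | zero => simp [weight1]
  | succ k ih =>
    rw [weight1, ih, Fin.prod_univ_castSucc]
    rfl

theorem weight2_eq_prod [Fintype B] (τ : Strategy2 A B) (k : ℕ) (c : Fin k → A × B) :
    weight2 τ k c = ∏ i : Fin k, (τ i (fun j => c (j.castLE i.isLt.le)) : B → ℝ) (c i).2 := by
  induction k with
  | zero => simp [weight2]
  | succ k ih =>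
    rw [weight2, ih, Fin.prod_univ_castSucc]
    rfl

/-- Nature and the two players enter through separate factors, so payoffs are linear in each
player's realization weights. Mixing, continuity and the computation of beliefs all rest on this. -/
theorem playProb_eq [Fintype A] [Fintype B] (Q : Matrix S S ℝ) (p : S → ℝ) (σ : Strategy1 S A)
    (τ : Strategy2 A B) (k : ℕ) (h : Fin (k + 1) → S × A × B) :
    playProb Q p σ τ k h = chainWeight Q p k (fun i => (h i).1) *
      weight1 σ (k + 1) (fun i => (h i).1) (fun i => (h i).2.1) *
      weight2 τ (k + 1) (fun i => (h i).2) := by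
  rw [playProb, Finset.prod_mul_distrib, chainWeight_eq_prod, weight1_eq_prod, weight2_eq_prod]
  ring

theorem sum_fin_succ_function {T M : Type*} [Fintype T] [AddCommMonoid M] (k : ℕ)
    (F : (Fin (k + 1) → T) → M) :
    ∑ f, F f = ∑ c : Fin k → T, ∑ x, F (Fin.snoc (α := fun _ => T) c x) := by
  rw [Finset.sum_comm, ← Fintype.sum_prod_type' (fun x c => F (Fin.snoc (α := fun _ => T) c x))]
  exact ((Fin.snocEquiv fun _ => T).sum_comp F).symm

theorem fst_comp_snoc (k : ℕ) (c : Fin k → A × B) (x : A × B) :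
    (fun i => (Fin.snoc (α := fun _ => A × B) c x i).1) =
      Fin.snoc (α := fun _ => A) (fun i => (c i).1) x.1 := by
  ext i
  refine Fin.lastCases ?_ (fun i => ?_) i <;> simp

theorem weight1_snoc [Fintype A] (σ : Strategy1 S A) (k : ℕ) (s : Fin (k + 1) → S)
    (α : Fin k → A) (a : A) :
    weight1 σ (k + 1) s (Fin.snoc (α := fun _ => A) α a) =
      weight1 σ k (Fin.init s) α * (σ k s α : A → ℝ) a := by
  simp [weight1, Fin.init_snoc, Fin.snoc_last]

theorem weight2_snoc [Fintype B] (τ : Strategy2 A B) (k : ℕ) (c : Fin k → A × B) (x : A × B) :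
    weight2 τ (k + 1) (Fin.snoc (α := fun _ => A × B) c x) =
      weight2 τ k c * (τ k c : B → ℝ) x.2 := by
  simp [weight2, Fin.init_snoc, Fin.snoc_last]

theorem chainWeight_nonneg {Q : Matrix S S ℝ} (hQ : ∀ s s', 0 ≤ Q s s') {p : S → ℝ}
    (hp : ∀ s, 0 ≤ p s) (k : ℕ) (s : Fin (k + 1) → S) : 0 ≤ chainWeight Q p k s := by
  rw [chainWeight_eq_prod]
  exact mul_nonneg (hp _) (Finset.prod_nonneg fun i _ => hQ _ _)

theorem weight1_nonneg [Fintype A] (σ : Strategy1 S A) (k : ℕ) (s : Fin k → S) (a : Fin k → A) :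
    0 ≤ weight1 σ k s a := by
  rw [weight1_eq_prod]
  exact Finset.prod_nonneg fun i _ => (σ _ _ _).2.1 _

theorem weight2_nonneg [Fintype B] (τ : Strategy2 A B) (k : ℕ) (c : Fin k → A × B) :
    0 ≤ weight2 τ k c := by
  rw [weight2_eq_prod]
  exact Finset.prod_nonneg fun i _ => (τ _ _).2.1 _

variable [Fintype A] [Fintype B]

theorem sum_simplex_mul {T : Type*} [Fintype T] (x : stdSimplex ℝ T) :
    ∑ t, (x : T → ℝ) t = 1 := x.2.2

theorem sum_weight1_mul_weight2 (σ : Strategy1 S A) (τ : Strategy2 A B) (k : ℕ) (s : Fin k → S) :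
    ∑ c : Fin k → A × B, weight1 σ k s (fun i => (c i).1) * weight2 τ k c = 1 := by
  induction k with
  | zero => simp [weight1, weight2]
  | succ k ih =>
    rw [sum_fin_succ_function, ← ih (Fin.init s)]
    refine Finset.sum_congr rfl fun c _ => ?_
    simp only [fst_comp_snoc, weight1_snoc, weight2_snoc]
    rw [Fintype.sum_prod_type]
    have h1 : ∀ a b, weight1 σ k (Fin.init s) (fun i => (c i).1) *
        (σ k s (fun i => (c i).1) : A → ℝ) a * (weight2 τ k c * (τ k c : B → ℝ) b) =
        weight1 σ k (Fin.init s) (fun i => (c i).1) * weight2 τ k c *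
        (σ k s (fun i => (c i).1) : A → ℝ) a * (τ k c : B → ℝ) b := fun a b => by ring
    simp only [h1, ← Finset.mul_sum, sum_simplex_mul, mul_one]

variable [Fintype S]

theorem stagePayoff_eq (g : S → A → B → ℝ) (Q : Matrix S S ℝ) (p : S → ℝ) (σ : Strategy1 S A)
    (τ : Strategy2 A B) (k : ℕ) :
    stagePayoff g Q p σ τ k =
      ∑ s : Fin (k + 1) → S, ∑ c : Fin k → A × B,
        chainWeight Q p k s * weight1 σ k (Fin.init s) (fun i => (c i).1) * weight2 τ k c *
          ∑ a, ∑ b, (σ k s (fun i => (c i).1) : A → ℝ) a * (τ k c : B → ℝ) b *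
            g (s (Fin.last k)) a b := by
  have h1 : stagePayoff g Q p σ τ k = ∑ s : Fin (k + 1) → S, ∑ c : Fin (k + 1) → A × B,
      chainWeight Q p k s * weight1 σ (k + 1) s (fun i => (c i).1) * weight2 τ (k + 1) c *
        g (s (Fin.last k)) (c (Fin.last k)).1 (c (Fin.last k)).2 := by
    rw [stagePayoff, ← Fintype.sum_prod_type',
      ← (Equiv.arrowProdEquivProdArrow (Fin (k + 1)) (fun _ => S) (fun _ => A × B)).sum_comp]
    refine Finset.sum_congr rfl fun h _ => ?_
    rw [playProb_eq]
    rfl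
  rw [h1]
  refine Finset.sum_congr rfl fun s _ => ?_
  rw [sum_fin_succ_function]
  refine Finset.sum_congr rfl fun c _ => ?_
  rw [Fintype.sum_prod_type, Finset.mul_sum]
  refine Finset.sum_congr rfl fun a _ => ?_
  rw [Finset.mul_sum]
  refine Finset.sum_congr rfl fun b _ => ?_
  rw [fst_comp_snoc, weight1_snoc, weight2_snoc, Fin.snoc_last]
  ring

/-- Law of the state at stage `k`. -/
def law (Q : Matrix S S ℝ) (p : S → ℝ) : ℕ → S → ℝ
  | 0 => p
  | k + 1 => fun s => ∑ s', law Q p k s' * Q s' s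

theorem sum_chainWeight_mul (Q : Matrix S S ℝ) (p : S → ℝ) (k : ℕ) (F : S → ℝ) :
    ∑ s : Fin (k + 1) → S, chainWeight Q p k s * F (s (Fin.last k)) = ∑ s, law Q p k s * F s := by
  induction k generalizing F with
  | zero =>
    exact (Equiv.funUnique (Fin 1) S).sum_comp (fun s => p s * F s)
  | succ k ih =>
    rw [sum_fin_succ_function]
    have h1 : ∀ s : Fin (k + 1) → S, ∑ x, chainWeight Q p (k + 1)
        (Fin.snoc (α := fun _ => S) s x) *
          F (Fin.snoc (α := fun _ => S) s x (Fin.last (k + 1))) =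
        chainWeight Q p k s * ∑ x, Q (s (Fin.last k)) x * F x := by
      intro s
      rw [Finset.mul_sum]
      refine Finset.sum_congr rfl fun x _ => ?_
      rw [chainWeight, Fin.init_snoc, Fin.snoc_castSucc, Fin.snoc_last, mul_assoc]
    simp only [h1]
    -- The last transition is absorbed into the test function, which is why the induction
    -- generalizes `F`.
    rw [ih fun s => ∑ x, Q s x * F x]
    simp only [law, Finset.mul_sum, Finset.sum_mul]
    rw [Finset.sum_comm]
    simp only [mul_assoc]

theorem law_mem {Q : Matrix S S ℝ} (hQ : ∀ s s', 0 ≤ Q s s') (hQ' : ∀ s, ∑ s', Q s s' = 1)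
    {p : S → ℝ} (hp : p ∈ stdSimplex ℝ S) (k : ℕ) : law Q p k ∈ stdSimplex ℝ S := by
  induction k with
  | zero => exact hp
  | succ k ih =>
    refine ⟨fun s => Finset.sum_nonneg fun s' _ => mul_nonneg (ih.1 s') (hQ s' s), ?_⟩
    simp only [law]
    rw [Finset.sum_comm]
    simp only [← Finset.mul_sum, hQ', mul_one]
    exact ih.2

theorem law_semigroup [DecidableEq S] (R : Matrix S S ℝ) (p : S → ℝ) (h : ℝ) (k : ℕ) :
    law (semigroup R h) p k = beliefFlow R p (k * h) := by
  induction k with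
  | zero => simp [law, beliefFlow_zero]
  | succ k ih =>
    rw [Nat.cast_succ, add_mul, one_mul, beliefFlow_add, ← ih]
    ext s
    rw [beliefFlow_apply]
    rfl

theorem abs_sum_simplex_mul_le {T : Type*} [Fintype T] {x : T → ℝ} (hx : x ∈ stdSimplex ℝ T)
    {F : T → ℝ} {M : ℝ} (hF : ∀ t, |F t| ≤ M) : |∑ t, x t * F t| ≤ M := by
  calc |∑ t, x t * F t| ≤ ∑ t, x t * M := by
        refine (Finset.abs_sum_le_sum_abs _ _).trans (Finset.sum_le_sum fun t _ => ?_)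
        rw [abs_mul, abs_of_nonneg (hx.1 t)]
        exact mul_le_mul_of_nonneg_left (hF t) (hx.1 t)
    _ = M := by rw [← Finset.sum_mul, hx.2, one_mul]

theorem abs_stagePayoff_le {g : S → A → B → ℝ} {M : ℝ} (hg : ∀ s a b, |g s a b| ≤ M)
    {Q : Matrix S S ℝ} (hQ : ∀ s s', 0 ≤ Q s s') (hQ' : ∀ s, ∑ s', Q s s' = 1)
    {p : S → ℝ} (hp : p ∈ stdSimplex ℝ S) (σ : Strategy1 S A) (τ : Strategy2 A B) (k : ℕ) :
    |stagePayoff g Q p σ τ k| ≤ M := by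
  rw [stagePayoff_eq]
  have h0 : ∀ s a c, 0 ≤ chainWeight Q p k s * weight1 σ k (Fin.init s) a * weight2 τ k c :=
    fun s a c => mul_nonneg (mul_nonneg (chainWeight_nonneg hQ hp.1 _ _) (weight1_nonneg _ _ _ _))
      (weight2_nonneg _ _ _)
  have h1 : ∀ (s : Fin (k + 1) → S) (c : Fin k → A × B),
      |∑ a, ∑ b, (σ k s (fun i => (c i).1) : A → ℝ) a * (τ k c : B → ℝ) b *
        g (s (Fin.last k)) a b| ≤ M := by
    intro s c
    simp only [mul_assoc, ← Finset.mul_sum]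
    exact abs_sum_simplex_mul_le (σ k s _).2 fun a =>
      abs_sum_simplex_mul_le (τ k c).2 fun b => hg _ _ _
  calc _ ≤ ∑ s : Fin (k + 1) → S, ∑ c : Fin k → A × B,
        chainWeight Q p k s * weight1 σ k (Fin.init s) (fun i => (c i).1) * weight2 τ k c * M := by
        refine (Finset.abs_sum_le_sum_abs _ _).trans (Finset.sum_le_sum fun s _ => ?_)
        refine (Finset.abs_sum_le_sum_abs _ _).trans (Finset.sum_le_sum fun c _ => ?_)
        rw [abs_mul, abs_of_nonneg (h0 _ _ _)]
        exact mul_le_mul_of_nonneg_left (h1 s c) (h0 _ _ _)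
    _ = M := by
        simp only [← Finset.sum_mul]
        simp only [mul_assoc, ← Finset.mul_sum, sum_weight1_mul_weight2]
        rw [sum_chainWeight_mul Q p k fun _ => 1, ← Finset.sum_mul, (law_mem hQ hQ' hp k).2]
        ring

end Weights

/-! ### Mixtures of behaviour strategies -/

section Mixing

variable {S A B : Type*} [Fintype B]

/-- The identity is kept multiplied by the total weight, so that histories of weight zero, where any
mixed action will do, need no exception. -/
theorem exists_simplex_mix {T : Type*} [Fintype T] (x₀ x₁ : stdSimplex ℝ T) {w₀ w₁ : ℝ}
    (h₀ : 0 ≤ w₀) (h₁ : 0 ≤ w₁) :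
    ∃ z : stdSimplex ℝ T, ∀ t, (w₀ + w₁) * (z : T → ℝ) t =
      w₀ * (x₀ : T → ℝ) t + w₁ * (x₁ : T → ℝ) t := by
  rcases (add_nonneg h₀ h₁).eq_or_lt with h | h
  · have e₀ : w₀ = 0 := by linarith
    have e₁ : w₁ = 0 := by linarith
    exact ⟨x₀, fun t => by simp [e₀, e₁]⟩
  · refine ⟨⟨fun t => (w₀ * (x₀ : T → ℝ) t + w₁ * (x₁ : T → ℝ) t) / (w₀ + w₁), fun t => ?_, ?_⟩,
      fun t => ?_⟩
    · exact div_nonneg (add_nonneg (mul_nonneg h₀ (x₀.2.1 t)) (mul_nonneg h₁ (x₁.2.1 t))) h.le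
    · rw [← Finset.sum_div, Finset.sum_add_distrib, ← Finset.mul_sum, ← Finset.mul_sum,
        sum_simplex_mul, sum_simplex_mul, mul_one, mul_one, div_self h.ne']
    · exact mul_div_cancel₀ _ h.ne'

/-- Kuhn's argument: after each history, average the two mixed actions with the posterior
probabilities that the history came from `τ₀` or `τ₁`. The realization weights then mix exactly. -/
theorem exists_strategy2_mix (τ₀ τ₁ : Strategy2 A B) {t : ℝ} (h₀ : 0 ≤ t) (h₁ : t ≤ 1) :
    ∃ τ : Strategy2 A B, ∀ k c,
      weight2 τ k c = (1 - t) * weight2 τ₀ k c + t * weight2 τ₁ k c := by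
  choose τ hτ using fun (k : ℕ) (c : Fin k → A × B) =>
    exists_simplex_mix (τ₀ k c) (τ₁ k c)
      (mul_nonneg (sub_nonneg.2 h₁) (weight2_nonneg τ₀ k c))
      (mul_nonneg h₀ (weight2_nonneg τ₁ k c))
  refine ⟨τ, fun k => ?_⟩
  induction k with
  | zero => intro c; simp [weight2]
  | succ k ih =>
    intro c
    rw [weight2, ih, hτ, weight2, weight2]
    ring

variable [Fintype A]

theorem exists_strategy1_mix (σ₀ σ₁ : Strategy1 S A) {t : ℝ} (h₀ : 0 ≤ t) (h₁ : t ≤ 1) :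
    ∃ σ : Strategy1 S A, ∀ k s a,
      weight1 σ k s a = (1 - t) * weight1 σ₀ k s a + t * weight1 σ₁ k s a := by
  choose σ hσ using fun (k : ℕ) (s : Fin (k + 1) → S) (a : Fin k → A) =>
    exists_simplex_mix (σ₀ k s a) (σ₁ k s a)
      (mul_nonneg (sub_nonneg.2 h₁) (weight1_nonneg σ₀ k (Fin.init s) a))
      (mul_nonneg h₀ (weight1_nonneg σ₁ k (Fin.init s) a))
  refine ⟨σ, fun k => ?_⟩
  induction k with
  | zero => intro s a; simp [weight1]
  | succ k ih =>
    intro s a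
    rw [weight1, ih, hσ, weight1, weight1]
    ring

theorem continuous_weight1 (k : ℕ) (s : Fin k → S) (a : Fin k → A) :
    Continuous fun σ : Strategy1 S A => weight1 σ k s a := by
  induction k with
  | zero => exact continuous_const
  | succ k ih =>
    refine (ih _ _).mul ((continuous_apply _).comp (continuous_subtype_val.comp ?_))
    exact (continuous_apply (Fin.init a)).comp ((continuous_apply s).comp (continuous_apply k))

variable [Fintype S]

theorem stagePayoff_mix_left (g : S → A → B → ℝ) (Q : Matrix S S ℝ) (p : S → ℝ)
    {σ σ₀ σ₁ : Strategy1 S A} {t : ℝ}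
    (h : ∀ k s a, weight1 σ k s a = (1 - t) * weight1 σ₀ k s a + t * weight1 σ₁ k s a)
    (τ : Strategy2 A B) (k : ℕ) :
    stagePayoff g Q p σ τ k =
      (1 - t) * stagePayoff g Q p σ₀ τ k + t * stagePayoff g Q p σ₁ τ k := by
  simp only [stagePayoff, playProb_eq, h, Finset.mul_sum, ← Finset.sum_add_distrib]
  exact Finset.sum_congr rfl fun _ _ => by ring

theorem stagePayoff_mix_right (g : S → A → B → ℝ) (Q : Matrix S S ℝ) (p : S → ℝ)
    {τ τ₀ τ₁ : Strategy2 A B} {t : ℝ}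
    (h : ∀ k c, weight2 τ k c = (1 - t) * weight2 τ₀ k c + t * weight2 τ₁ k c)
    (σ : Strategy1 S A) (k : ℕ) :
    stagePayoff g Q p σ τ k =
      (1 - t) * stagePayoff g Q p σ τ₀ k + t * stagePayoff g Q p σ τ₁ k := by
  simp only [stagePayoff, playProb_eq, h, Finset.mul_sum, ← Finset.sum_add_distrib]
  exact Finset.sum_congr rfl fun _ _ => by ring

theorem continuous_stagePayoff (g : S → A → B → ℝ) (Q : Matrix S S ℝ) (p : S → ℝ)
    (τ : Strategy2 A B) (k : ℕ) : Continuous fun σ => stagePayoff g Q p σ τ k := by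
  simp only [stagePayoff, playProb_eq]
  exact continuous_finsetSum _ fun h _ =>
    ((continuous_const.mul (continuous_weight1 _ _ _)).mul continuous_const).mul continuous_const

end Mixing

/-! ### Discounted sums and existence of the value -/

section Value

theorem stageDiscount_pos {r : ℝ} (hr : 0 < r) {n : ℕ} (hn : 1 ≤ n) : 0 < stageDiscount r n := by
  have hn' : (0 : ℝ) < n := by exact_mod_cast hn
  rw [stageDiscount, sub_pos, Real.exp_lt_one_iff, neg_div, neg_lt_zero]
  positivity

theorem one_sub_stageDiscount (r : ℝ) (n : ℕ) : 1 - stageDiscount r n = Real.exp (-r / n) := by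
  rw [stageDiscount, sub_sub_cancel]

theorem stageDiscount_lt_one (r : ℝ) (n : ℕ) : stageDiscount r n < 1 := by
  have := Real.exp_pos (-r / n)
  rw [stageDiscount]
  linarith

theorem hasSum_discount {l : ℝ} (h₀ : 0 < l) (h₁ : l < 1) :
    HasSum (fun k : ℕ => l * (1 - l) ^ k) 1 := by
  have h := (hasSum_geometric_of_lt_one (by linarith : 0 ≤ 1 - l) (by linarith)).mul_left l
  rwa [sub_sub_cancel, mul_inv_cancel₀ h₀.ne'] at h

theorem summable_discount_mul {l : ℝ} (h₀ : 0 < l) (h₁ : l < 1) {F : ℕ → ℝ} {M : ℝ}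
    (hF : ∀ k, |F k| ≤ M) : Summable fun k => l * (1 - l) ^ k * F k := by
  refine Summable.of_norm_bounded ((hasSum_discount h₀ h₁).summable.mul_right M) fun k => ?_
  have h2 : 0 ≤ l * (1 - l) ^ k := mul_nonneg h₀.le (pow_nonneg (by linarith) k)
  rw [Real.norm_eq_abs, abs_mul, abs_of_nonneg h2]
  exact mul_le_mul_of_nonneg_left (hF k) h2

theorem tsum_discount_mul_le {l : ℝ} (h₀ : 0 < l) (h₁ : l < 1) {F G : ℕ → ℝ} {M M' : ℝ}
    (hF : ∀ k, |F k| ≤ M) (hG : ∀ k, |G k| ≤ M') (hFG : ∀ k, F k ≤ G k) :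
    ∑' k, l * (1 - l) ^ k * F k ≤ ∑' k, l * (1 - l) ^ k * G k :=
  (summable_discount_mul h₀ h₁ hF).tsum_le_tsum
    (fun k => mul_le_mul_of_nonneg_left (hFG k)
      (mul_nonneg h₀.le (pow_nonneg (by linarith) k))) (summable_discount_mul h₀ h₁ hG)

theorem abs_tsum_discount_mul_le {l : ℝ} (h₀ : 0 < l) (h₁ : l < 1) {F : ℕ → ℝ} {M : ℝ}
    (hF : ∀ k, |F k| ≤ M) : |∑' k, l * (1 - l) ^ k * F k| ≤ M := by
  have hM : 0 ≤ M := (abs_nonneg _).trans (hF 0)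
  have hc : ∀ x : ℝ, |x| ≤ M → ∑' k : ℕ, l * (1 - l) ^ k * x = x := fun x _ => by
    rw [tsum_mul_right, (hasSum_discount h₀ h₁).tsum_eq, one_mul]
  refine abs_le.2 ⟨?_, ?_⟩
  · rw [← hc (-M) (by rw [abs_neg, abs_of_nonneg hM])]
    exact tsum_discount_mul_le h₀ h₁ (fun _ => (abs_neg M).le) hF fun k => (abs_le.1 (hF k)).1
  · rw [← hc M (by rw [abs_of_nonneg hM])]
    exact tsum_discount_mul_le h₀ h₁ hF (fun _ => le_rfl) fun k => (abs_le.1 (hF k)).2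

theorem tsum_discount_mul_mix {l : ℝ} (h₀ : 0 < l) (h₁ : l < 1) {F₀ F₁ : ℕ → ℝ} {M : ℝ}
    (hF₀ : ∀ k, |F₀ k| ≤ M) (hF₁ : ∀ k, |F₁ k| ≤ M) (x y : ℝ) :
    ∑' k, l * (1 - l) ^ k * (x * F₀ k + y * F₁ k) =
      x * ∑' k, l * (1 - l) ^ k * F₀ k + y * ∑' k, l * (1 - l) ^ k * F₁ k := by
  rw [← tsum_mul_left, ← tsum_mul_left,
    ← ((summable_discount_mul h₀ h₁ hF₀).mul_left x).tsum_add
      ((summable_discount_mul h₀ h₁ hF₁).mul_left y)]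
  exact tsum_congr fun k => by ring

variable {S A B : Type*} [Fintype S] [Fintype A] [Fintype B]

theorem exists_payoff_bound (g : S → A → B → ℝ) : ∃ M, 0 ≤ M ∧ ∀ s a b, |g s a b| ≤ M := by
  refine ⟨∑ s, ∑ a, ∑ b, |g s a b|, by positivity, fun s a b => ?_⟩
  have h1 : |g s a b| ≤ ∑ b, |g s a b| :=
    Finset.single_le_sum (f := fun b => |g s a b|) (fun _ _ => abs_nonneg _) (Finset.mem_univ b)
  have h2 : ∑ b, |g s a b| ≤ ∑ a, ∑ b, |g s a b| :=
    Finset.single_le_sum (f := fun a => ∑ b, |g s a b|)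
      (fun _ _ => Finset.sum_nonneg fun _ _ => abs_nonneg _) (Finset.mem_univ a)
  have h3 : ∑ a, ∑ b, |g s a b| ≤ ∑ s, ∑ a, ∑ b, |g s a b| :=
    Finset.single_le_sum (f := fun s => ∑ a, ∑ b, |g s a b|)
      (fun _ _ => Finset.sum_nonneg fun _ _ => Finset.sum_nonneg fun _ _ => abs_nonneg _)
      (Finset.mem_univ s)
  linarith

variable [DecidableEq S] {g : S → A → B → ℝ} {M : ℝ} {R : Matrix S S ℝ} {r : ℝ} {n : ℕ} {p : S → ℝ}

theorem abs_stagePayoff_semigroup_le (hg : ∀ s a b, |g s a b| ≤ M) (hR : IsGenerator R)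
    (hp : p ∈ stdSimplex ℝ S) (σ : Strategy1 S A) (τ : Strategy2 A B) (k : ℕ) :
    |stagePayoff g (semigroup R (1 / (n : ℝ))) p σ τ k| ≤ M :=
  abs_stagePayoff_le hg (semigroup_nonneg hR (by positivity)) (semigroup_row_sum hR _) hp σ τ k

theorem abs_gamePayoff_le (hg : ∀ s a b, |g s a b| ≤ M) (hR : IsGenerator R) (hr : 0 < r)
    (hn : 1 ≤ n) (hp : p ∈ stdSimplex ℝ S) (σ : Strategy1 S A) (τ : Strategy2 A B) :
    |gamePayoff g R r n p σ τ| ≤ M :=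
  abs_tsum_discount_mul_le (stageDiscount_pos hr hn) (stageDiscount_lt_one r n)
    (abs_stagePayoff_semigroup_le hg hR hp σ τ)

instance [Nonempty A] : Nonempty (Strategy1 S A) :=
  ⟨fun _ _ _ => Classical.arbitrary _⟩

instance [Nonempty B] : Nonempty (Strategy2 A B) :=
  ⟨fun _ _ => Classical.arbitrary _⟩

/-- Every game `G_n(p)` has a value. -/
theorem isValue_gamePayoff [Nonempty A] [Nonempty B] (g : S → A → B → ℝ) (hR : IsGenerator R)
    (hr : 0 < r) (hn : 1 ≤ n) (hp : p ∈ stdSimplex ℝ S) :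
    IsValue (gamePayoff g R r n p) (lowerValue (gamePayoff g R r n p)) := by
  obtain ⟨M, -, hg⟩ := exists_payoff_bound g
  have hl := stageDiscount_pos hr hn
  have hl' := stageDiscount_lt_one r n
  have hst := abs_stagePayoff_semigroup_le (n := n) hg hR hp
  refine isValue_lowerValue (abs_gamePayoff_le hg hR hr hn hp) ?_
  -- `Strategy1` is a product of simplices, hence compact. The payoff is continuous on it because
  -- each stage involves finitely many coordinates and discounting makes the series converge
  -- uniformly.
  refine exists_forall_le_of_convexlike _ (fun τ => ?_) (fun σ₀ σ₁ t h₀ h₁ => ?_)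
    (fun τ₀ τ₁ t h₀ h₁ => ?_)
  · refine continuous_tsum (fun k => continuous_const.mul (continuous_stagePayoff g _ p τ k))
      ((hasSum_discount hl hl').summable.mul_right M) fun k σ => ?_
    have h2 : 0 ≤ stageDiscount r n * (1 - stageDiscount r n) ^ k :=
      mul_nonneg hl.le (pow_nonneg (by linarith) k)
    rw [Real.norm_eq_abs, abs_mul, abs_of_nonneg h2]
    exact mul_le_mul_of_nonneg_left (hst σ τ k) h2
  · obtain ⟨σ, hσ⟩ := exists_strategy1_mix σ₀ σ₁ h₀ h₁
    refine ⟨σ, fun τ => le_of_eq ?_⟩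
    rw [gamePayoff, gamePayoff, gamePayoff,
      ← tsum_discount_mul_mix hl hl' (hst σ₀ τ) (hst σ₁ τ)]
    simp only [stagePayoff_mix_left g _ p hσ]
  · obtain ⟨τ, hτ⟩ := exists_strategy2_mix τ₀ τ₁ h₀ h₁
    refine ⟨τ, fun σ => le_of_eq ?_⟩
    rw [gamePayoff, gamePayoff, gamePayoff,
      ← tsum_discount_mul_mix hl hl' (hst σ τ₀) (hst σ τ₁)]
    simp only [stagePayoff_mix_right g _ p hτ]

end Value

/-! ### The one-shot value and what player 1 guarantees -/

section LowerBound

variable {S A B : Type*} [Fintype S] [Fintype A] [Fintype B]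
  {g : S → A → B → ℝ} {M : ℝ}

theorem abs_oneShotPayoff_le (hg : ∀ s a b, |g s a b| ≤ M) {p : S → ℝ} (hp : p ∈ stdSimplex ℝ S)
    (x : stdSimplex ℝ A) (y : stdSimplex ℝ B) : |oneShotPayoff g p x y| ≤ M := by
  simp only [oneShotPayoff, mul_assoc, ← Finset.mul_sum]
  exact abs_sum_simplex_mul_le x.2 fun a => abs_sum_simplex_mul_le y.2 fun b =>
    abs_sum_simplex_mul_le hp fun s => hg s a b

theorem sum_mul_sum_sum_eq_oneShotPayoff (g : S → A → B → ℝ) (p : S → ℝ) (x : stdSimplex ℝ A)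
    (y : stdSimplex ℝ B) :
    ∑ s, p s * ∑ a, ∑ b, (x : A → ℝ) a * (y : B → ℝ) b * g s a b = oneShotPayoff g p x y := by
  simp only [oneShotPayoff, Finset.mul_sum]
  rw [Finset.sum_comm]
  refine Finset.sum_congr rfl fun a _ => ?_
  rw [Finset.sum_comm]
  exact Finset.sum_congr rfl fun b _ => Finset.sum_congr rfl fun s _ => by ring

theorem exists_forall_oneShotValue_sub_le [Nonempty A] (hg : ∀ s a b, |g s a b| ≤ M) {p : S → ℝ}
    (hp : p ∈ stdSimplex ℝ S) {ε : ℝ} (hε : 0 < ε) :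
    ∃ x, ∀ y, oneShotValue g p - ε ≤ oneShotPayoff g p x y := by
  obtain ⟨x, hx⟩ := exists_forall_lt_of_lt_lowerValue (abs_oneShotPayoff_le hg hp)
    (sub_lt_self (oneShotValue g p) hε)
  exact ⟨x, fun y => (hx y).le⟩

theorem exists_oneShotPayoff_le [Nonempty B] (hg : ∀ s a b, |g s a b| ≤ M) {p : S → ℝ}
    (hp : p ∈ stdSimplex ℝ S) {ε : ℝ} (hε : 0 < ε) (x : stdSimplex ℝ A) :
    ∃ y, oneShotPayoff g p x y ≤ oneShotValue g p + ε := by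
  obtain ⟨y, hy⟩ := exists_lt_of_lowerValue_lt (abs_oneShotPayoff_le hg hp)
    (lt_add_of_pos_right (oneShotValue g p) hε) x
  exact ⟨y, hy.le⟩

theorem abs_oneShotValue_le [Nonempty A] [Nonempty B] (hg : ∀ s a b, |g s a b| ≤ M) {p : S → ℝ}
    (hp : p ∈ stdSimplex ℝ S) : |oneShotValue g p| ≤ M := by
  have h := abs_oneShotPayoff_le hg hp
  exact abs_le.2 ⟨le_lowerValue h (Classical.arbitrary _) fun y => (abs_le.1 (h _ y)).1,
    lowerValue_le h fun x => ⟨Classical.arbitrary _, (abs_le.1 (h x _)).2⟩⟩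

/-- A nearly optimal `x` at `p` faces a nearly optimal reply `y` at `q`. With `x` and `y` fixed, the
payoff is linear in the belief with coefficients bounded by `M`. -/
theorem oneShotValue_sub_le [Nonempty A] [Nonempty B] (hg : ∀ s a b, |g s a b| ≤ M) {p q : S → ℝ}
    (hp : p ∈ stdSimplex ℝ S) (hq : q ∈ stdSimplex ℝ S) :
    oneShotValue g p - oneShotValue g q ≤ M * ∑ s, |p s - q s| := by
  refine le_of_forall_pos_le_add fun ε hε => ?_
  obtain ⟨x, hx⟩ := exists_forall_oneShotValue_sub_le hg hp (half_pos hε)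
  obtain ⟨y, hy⟩ := exists_oneShotPayoff_le hg hq (half_pos hε) x
  have h1 : oneShotPayoff g p x y - oneShotPayoff g q x y ≤ M * ∑ s, |p s - q s| := by
    rw [← sum_mul_sum_sum_eq_oneShotPayoff, ← sum_mul_sum_sum_eq_oneShotPayoff,
      ← Finset.sum_sub_distrib, Finset.mul_sum]
    refine Finset.sum_le_sum fun s _ => ?_
    have h2 : |∑ a, ∑ b, (x : A → ℝ) a * (y : B → ℝ) b * g s a b| ≤ M := by
      simp only [mul_assoc, ← Finset.mul_sum]
      exact abs_sum_simplex_mul_le x.2 fun a => abs_sum_simplex_mul_le y.2 fun b => hg s a b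
    rw [← sub_mul, mul_comm M]
    refine (le_abs_self _).trans ?_
    rw [abs_mul]
    exact mul_le_mul_of_nonneg_left h2 (abs_nonneg _)
  linarith [hx y]

theorem abs_oneShotValue_sub_le [Nonempty A] [Nonempty B] (hg : ∀ s a b, |g s a b| ≤ M) {p q : S → ℝ}
    (hp : p ∈ stdSimplex ℝ S) (hq : q ∈ stdSimplex ℝ S) :
    |oneShotValue g p - oneShotValue g q| ≤ M * ∑ s, |p s - q s| := by
  refine abs_sub_le_iff.2 ⟨oneShotValue_sub_le hg hp hq, ?_⟩
  simpa only [abs_sub_comm] using oneShotValue_sub_le hg hq hp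

/-- By ignoring the state, player 1 guarantees the value of the average game at the current
law. -/
theorem exists_nonrevealing_strategy [Nonempty A] (hg : ∀ s a b, |g s a b| ≤ M) {Q : Matrix S S ℝ}
    (hQ : ∀ s s', 0 ≤ Q s s') (hQ' : ∀ s, ∑ s', Q s s' = 1) {p : S → ℝ}
    (hp : p ∈ stdSimplex ℝ S) {ε : ℝ} (hε : 0 < ε) :
    ∃ σ : Strategy1 S A, ∀ (τ : Strategy2 A B) k,
      oneShotValue g (law Q p k) - ε ≤ stagePayoff g Q p σ τ k := by
  choose x hx using fun k => exists_forall_oneShotValue_sub_le hg (law_mem hQ hQ' hp k) hε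
  have hS : Nonempty S := by
    by_contra h
    rw [not_nonempty_iff] at h
    simpa using hp.2
  obtain ⟨s₀⟩ := hS
  set σ : Strategy1 S A := fun k _ _ => x k with hσ
  refine ⟨σ, fun τ k => ?_⟩
  -- The actions carry no information on the states, so their weight can be computed along the
  -- constant path `s₀` and the states summed out first.
  have hw : ∀ (s : Fin k → S) a, weight1 σ k s a = weight1 σ k (fun _ => s₀) a := by
    intro s a
    rw [weight1_eq_prod, weight1_eq_prod]
  have h1 : stagePayoff g Q p σ τ k = ∑ c : Fin k → A × B,
      weight1 σ k (fun _ => s₀) (fun i => (c i).1) * weight2 τ k c *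
        oneShotPayoff g (law Q p k) (x k) (τ k c) := by
    rw [stagePayoff_eq, Finset.sum_comm]
    refine Finset.sum_congr rfl fun c _ => ?_
    rw [← sum_mul_sum_sum_eq_oneShotPayoff, ← sum_chainWeight_mul Q p k
      fun s => ∑ a, ∑ b, (x k : A → ℝ) a * (τ k c : B → ℝ) b * g s a b, Finset.mul_sum]
    refine Finset.sum_congr rfl fun s _ => ?_
    rw [hw]
    ring
  rw [h1, ← one_mul (_ - ε), ← sum_weight1_mul_weight2 σ τ k fun _ => s₀, Finset.sum_mul]
  exact Finset.sum_le_sum fun c _ => mul_le_mul_of_nonneg_left (hx k _)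
    (mul_nonneg (weight1_nonneg _ _ _ _) (weight2_nonneg _ _ _))

/-- By playing optimally given the current state, player 1 guarantees the average of the values of
the games with known state. -/
theorem exists_revealing_strategy [Nonempty A] [DecidableEq S] (hg : ∀ s a b, |g s a b| ≤ M)
    {Q : Matrix S S ℝ} (hQ : ∀ s s', 0 ≤ Q s s') (hQ' : ∀ s, ∑ s', Q s s' = 1) {p : S → ℝ}
    (hp : p ∈ stdSimplex ℝ S) {ε : ℝ} (hε : 0 < ε) :
    ∃ σ : Strategy1 S A, ∀ (τ : Strategy2 A B) k,
      ∑ s, law Q p k s * oneShotValue g (Pi.single s 1) - ε ≤ stagePayoff g Q p σ τ k := by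
  choose x hx using fun s : S =>
    exists_forall_oneShotValue_sub_le hg (single_mem_stdSimplex ℝ s) hε
  let σ : Strategy1 S A := fun k s _ => x (s (Fin.last k))
  refine ⟨σ, fun τ k => ?_⟩
  rw [stagePayoff_eq]
  have h1 : ∀ (s : S) (y : stdSimplex ℝ B), oneShotValue g (Pi.single s 1) - ε ≤
      ∑ a, ∑ b, (x s : A → ℝ) a * (y : B → ℝ) b * g s a b := by
    intro s y
    refine (hx s y).trans (le_of_eq ?_)
    simp [oneShotPayoff, Pi.single_apply]
  have h2 : ∑ s, law Q p k s * oneShotValue g (Pi.single s 1) - ε =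
      ∑ s, law Q p k s * (oneShotValue g (Pi.single s 1) - ε) := by
    simp only [mul_sub, Finset.sum_sub_distrib, ← Finset.sum_mul]
    rw [(law_mem hQ hQ' hp k).2, one_mul]
  rw [h2, ← sum_chainWeight_mul Q p k fun s => oneShotValue g (Pi.single s 1) - ε]
  refine Finset.sum_le_sum fun s _ => ?_
  have h3 : chainWeight Q p k s * (oneShotValue g (Pi.single (s (Fin.last k)) 1) - ε) =
      ∑ c : Fin k → A × B, chainWeight Q p k s * weight1 σ k (Fin.init s) (fun i => (c i).1) *
        weight2 τ k c * (oneShotValue g (Pi.single (s (Fin.last k)) 1) - ε) := by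
    rw [← Finset.sum_mul]
    congr 1
    simp only [mul_assoc, ← Finset.mul_sum, sum_weight1_mul_weight2, mul_one]
  rw [h3]
  exact Finset.sum_le_sum fun c _ => mul_le_mul_of_nonneg_left (h1 (s (Fin.last k)) (τ k c))
    (mul_nonneg (mul_nonneg (chainWeight_nonneg hQ hp.1 k s) (weight1_nonneg _ _ _ _))
      (weight2_nonneg τ k c))

variable [DecidableEq S] {R : Matrix S S ℝ} {r : ℝ} {n : ℕ} {p : S → ℝ}

theorem tsum_discount_le_lowerValue [Nonempty B] (hg : ∀ s a b, |g s a b| ≤ M) (hR : IsGenerator R)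
    (hr : 0 < r) (hn : 1 ≤ n) (hp : p ∈ stdSimplex ℝ S) {F : ℕ → ℝ} {M' : ℝ}
    (hF : ∀ k, |F k| ≤ M')
    (h : ∀ ε > 0, ∃ σ : Strategy1 S A, ∀ (τ : Strategy2 A B) k,
      F k - ε ≤ stagePayoff g (semigroup R (1 / (n : ℝ))) p σ τ k) :
    ∑' k, stageDiscount r n * (1 - stageDiscount r n) ^ k * F k ≤
      lowerValue (gamePayoff g R r n p) := by
  have hl := stageDiscount_pos hr hn
  have hl' := stageDiscount_lt_one r n
  refine le_of_forall_pos_le_add fun ε hε => ?_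
  obtain ⟨σ, hσ⟩ := h ε hε
  rw [← sub_le_iff_le_add]
  refine le_lowerValue (abs_gamePayoff_le hg hR hr hn hp) σ fun τ => ?_
  have h2 := tsum_discount_mul_mix hl hl' (F₀ := F) (F₁ := fun _ => 1) (M := max M' 1)
    (fun k => (hF k).trans (le_max_left _ _)) (fun k => by simp) 1 (-ε)
  simp only [mul_one, one_mul, (hasSum_discount hl hl').tsum_eq] at h2
  rw [sub_eq_add_neg, ← h2]
  refine tsum_discount_mul_le hl hl' (M := M' + ε) (M' := M) (fun k => ?_)
    (abs_stagePayoff_semigroup_le hg hR hp σ τ) fun k => ?_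
  · refine (abs_add_le _ _).trans (add_le_add (hF k) ?_)
    rw [abs_neg, abs_of_pos hε]
  · linarith [hσ τ k]

end LowerBound

/-! ### Quadratic control of the variation of beliefs -/

section Energy

variable {S : Type*} [Fintype S]

/-- Total mass of an unnormalized belief. -/
def mass (μ : S → ℝ) : ℝ := ∑ s, μ s

/-- The squared Euclidean norm of the normalization of `μ`, multiplied by the mass of `μ`. -/
def energy (μ : S → ℝ) : ℝ := ∑ s, μ s ^ 2 / mass μ

theorem mass_nonneg {μ : S → ℝ} (hμ : ∀ s, 0 ≤ μ s) : 0 ≤ mass μ :=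
  Finset.sum_nonneg fun s _ => hμ s

theorem le_mass {μ : S → ℝ} (hμ : ∀ s, 0 ≤ μ s) (s : S) : μ s ≤ mass μ :=
  Finset.single_le_sum (fun s _ => hμ s) (Finset.mem_univ s)

theorem eq_zero_of_mass_eq_zero {μ : S → ℝ} (hμ : ∀ s, 0 ≤ μ s) (h : mass μ = 0) (s : S) :
    μ s = 0 :=
  le_antisymm (h ▸ le_mass hμ s) (hμ s)

theorem div_mass_mem {μ : S → ℝ} (hμ : ∀ s, 0 ≤ μ s) (h : 0 < mass μ) :
    (fun s => μ s / mass μ) ∈ stdSimplex ℝ S :=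
  ⟨fun s => div_nonneg (hμ s) h.le, by rw [← Finset.sum_div]; exact div_self h.ne'⟩

theorem energy_nonneg {μ : S → ℝ} (hμ : ∀ s, 0 ≤ μ s) : 0 ≤ energy μ :=
  Finset.sum_nonneg fun _ _ => div_nonneg (sq_nonneg _) (mass_nonneg hμ)

theorem energy_le_mass {μ : S → ℝ} (hμ : ∀ s, 0 ≤ μ s) : energy μ ≤ mass μ := by
  refine Finset.sum_le_sum fun s _ => ?_
  refine div_le_of_le_mul₀ (mass_nonneg hμ) (hμ s) ?_
  rw [sq]
  exact mul_le_mul_of_nonneg_left (le_mass hμ s) (hμ s)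

/-- This is |d| ≤ δ + d²/(4δ) for d = m/w - p, multiplied by w and with the square expanded. At w =
0 both sides are zero, by the convention on division by zero. -/
theorem abs_sub_mul_le {m w p δ : ℝ} (hw : 0 ≤ w) (hm : w = 0 → m = 0) (hδ : 0 < δ) :
    |m - w * p| ≤ δ * w + 1 / (4 * δ) * (m ^ 2 / w - 2 * p * m + p ^ 2 * w) := by
  rcases hw.eq_or_lt with h | h
  · simp [hm h.symm, ← h]
  · have h1 : δ * w + 1 / (4 * δ) * (m ^ 2 / w - 2 * p * m + p ^ 2 * w) - |m - w * p| =
        (|m - w * p| - 2 * δ * w) ^ 2 / (4 * δ * w) := by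
      rw [sub_sq, sq_abs]
      field_simp
      ring
    have h2 : 0 ≤ (|m - w * p| - 2 * δ * w) ^ 2 / (4 * δ * w) := by positivity
    linarith

/-- The energy increment of a splitting controls the variation of beliefs. -/
theorem sum_abs_splitting_le {A : Type*} [Fintype A] {μ : A → S → ℝ} (hμ : ∀ a s, 0 ≤ μ a s)
    {β : S → ℝ} (hβ : ∀ s, β s = ∑ a, μ a s) {δ : ℝ} (hδ : 0 < δ) :
    ∑ a, ∑ s, |μ a s - mass (μ a) * (β s / mass β)| ≤
      Fintype.card S * δ * mass β + 1 / (4 * δ) * (∑ a, energy (μ a) - energy β) := by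
  have hmass : ∑ a, mass (μ a) = mass β := by
    simp only [mass, hβ]
    exact Finset.sum_comm
  have hβ0 : ∀ s, 0 ≤ β s := fun s => hβ s ▸ Finset.sum_nonneg fun a _ => hμ a s
  have h1 : ∀ s, ∑ a, |μ a s - mass (μ a) * (β s / mass β)| ≤
      δ * mass β + 1 / (4 * δ) * (∑ a, μ a s ^ 2 / mass (μ a) - β s ^ 2 / mass β) := by
    intro s
    refine (Finset.sum_le_sum fun a _ => abs_sub_mul_le (mass_nonneg (hμ a))
      (fun h => eq_zero_of_mass_eq_zero (hμ a) h s) hδ).trans (le_of_eq ?_)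
    -- Variance identity: with p = β/mass β, the cross term and the last term combine to -β²/mass β.
    rw [Finset.sum_add_distrib, ← Finset.mul_sum, hmass, ← Finset.mul_sum,
      Finset.sum_add_distrib, Finset.sum_sub_distrib, ← Finset.mul_sum, ← hβ, ← Finset.mul_sum,
      hmass]
    by_cases h0 : mass β = 0
    · simp [h0]
    · field_simp
      ring
  rw [Finset.sum_comm]
  refine (Finset.sum_le_sum fun s _ => h1 s).trans (le_of_eq ?_)
  rw [Finset.sum_add_distrib, Finset.sum_const, ← Finset.mul_sum, Finset.sum_sub_distrib,
    Finset.sum_comm]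
  simp only [ Finset.card_univ, nsmul_eq_mul, energy]
  ring

/-- The transition preserves mass and moves the normalized belief by at most `drift Q` in L1, and
the squared norm is 2-Lipschitz for the L1 distance on the simplex. -/
theorem energy_transition_ge [DecidableEq S] {Q : Matrix S S ℝ} (hQ : ∀ s s', 0 ≤ Q s s')
    (hQ' : ∀ s, ∑ s', Q s s' = 1) {μ : S → ℝ} (hμ : ∀ s, 0 ≤ μ s) :
    energy μ - 2 * drift Q * mass μ ≤ energy fun s => ∑ s', μ s' * Q s' s := by
  have hmass : mass (fun s => ∑ s', μ s' * Q s' s) = mass μ := by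
    rw [mass, Finset.sum_comm]
    simp only [← Finset.mul_sum, hQ', mul_one]
    rfl
  rcases (mass_nonneg hμ).eq_or_lt with h | h
  · simp [energy, hmass, ← h]
  have hq := div_mass_mem hμ h
  set q : S → ℝ := fun s => μ s / mass μ with hqdef
  set q' : S → ℝ := fun s => ∑ s', q s' * Q s' s with hqdef'
  have hq' : q' ∈ stdSimplex ℝ S := law_mem hQ hQ' hq 1
  have hle : ∀ {x : S → ℝ}, x ∈ stdSimplex ℝ S → ∀ s, x s ≤ 1 := fun hx s =>
    (Finset.single_le_sum (fun j _ => hx.1 j) (Finset.mem_univ s)).trans hx.2.le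
  have h1 : ∑ s, (q s ^ 2 - q' s ^ 2) ≤ 2 * drift Q := by
    calc ∑ s, (q s ^ 2 - q' s ^ 2) ≤ ∑ s, 2 * |q' s - q s| := by
          refine Finset.sum_le_sum fun s _ => ?_
          have h2 : q s ^ 2 - q' s ^ 2 = (q s + q' s) * (q s - q' s) := by ring
          rw [h2]
          refine (le_abs_self _).trans ?_
          rw [abs_mul, abs_sub_comm (q s), abs_of_nonneg (add_nonneg (hq.1 s) (hq'.1 s))]
          exact mul_le_mul_of_nonneg_right (by linarith [hle hq s, hle hq' s]) (abs_nonneg _)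
      _ ≤ 2 * drift Q := by
          rw [← Finset.mul_sum]
          exact mul_le_mul_of_nonneg_left (sum_abs_transition_sub_le Q hq) zero_le_two
  have h3 : energy μ = mass μ * ∑ s, q s ^ 2 := by
    rw [energy, Finset.mul_sum]
    refine Finset.sum_congr rfl fun s _ => ?_
    simp only [hqdef]
    field_simp
  have h4 : (energy fun s => ∑ s', μ s' * Q s' s) = mass μ * ∑ s, q' s ^ 2 := by
    rw [energy, hmass, Finset.mul_sum]
    refine Finset.sum_congr rfl fun s _ => ?_
    have h5 : ∑ s', μ s' * Q s' s = mass μ * q' s := by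
      simp only [hqdef', hqdef, Finset.mul_sum]
      refine Finset.sum_congr rfl fun s' _ => ?_
      field_simp
    rw [h5]
    field_simp
  rw [h3, h4]
  rw [Finset.sum_sub_distrib] at h1
  have h6 := mul_le_mul_of_nonneg_left h1 h.le
  linarith

end Energy

/-! ### Reply to an action correlated with the state -/

section BestResponse

variable {S A B : Type*} [Fintype S] [Fintype A] [Fintype B] [Nonempty B]

/-- A reply of player 2 to an action of player 1 that is correlated with the state. -/
theorem exists_reply {g : S → A → B → ℝ} {M : ℝ} (hg : ∀ s a b, |g s a b| ≤ M)
    {f : (S → ℝ) → ℝ} (hf : ∀ p ∈ stdSimplex ℝ S, oneShotValue g p ≤ f p)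
    {μ : A → S → ℝ} (hμ : ∀ a s, 0 ≤ μ a s) {β : S → ℝ} (hβ : ∀ s, β s = ∑ a, μ a s)
    {η : ℝ} (hη : 0 < η) :
    ∃ y : stdSimplex ℝ B, ∑ a, ∑ s, μ a s * ∑ b, (y : B → ℝ) b * g s a b ≤
      mass β * f (fun s => β s / mass β) + η * mass β +
        M * ∑ a, ∑ s, |μ a s - mass (μ a) * (β s / mass β)| := by
  have hmass : ∑ a, mass (μ a) = mass β := by
    simp only [mass, hβ]
    exact Finset.sum_comm
  have hβ0 : ∀ s, 0 ≤ β s := fun s => hβ s ▸ Finset.sum_nonneg fun a _ => hμ a s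
  rcases (mass_nonneg hβ0).eq_or_lt with h | h
  · have hμ0 : ∀ a s, μ a s = 0 := fun a s => eq_zero_of_mass_eq_zero (hμ a)
      (le_antisymm (by
        rw [h, ← hmass]
        exact Finset.single_le_sum (f := fun a => mass (μ a)) (fun a _ => mass_nonneg (hμ a))
          (Finset.mem_univ a)) (mass_nonneg (hμ a))) s
    refine ⟨Classical.arbitrary _, ?_⟩
    simp [hμ0, ← h]
  · have hp := div_mass_mem hβ0 h
    set p : S → ℝ := fun s => β s / mass β with hpdef
    -- The marginal law of the action. Player 2 replies as if the action were drawn from `x`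
    -- independently of the state.
    let x : stdSimplex ℝ A := ⟨fun a => mass (μ a) / mass β,
      fun a => div_nonneg (mass_nonneg (hμ a)) h.le, by
        rw [← Finset.sum_div, hmass, div_self h.ne']⟩
    obtain ⟨y, hy⟩ := exists_oneShotPayoff_le hg hp hη x
    refine ⟨y, ?_⟩
    -- The joint law is split into the product of its marginals, which yields the average game, and
    -- a correlation term.
    have h1 : ∑ a, ∑ s, μ a s * ∑ b, (y : B → ℝ) b * g s a b =
        mass β * oneShotPayoff g p x y +
          ∑ a, ∑ s, (μ a s - mass (μ a) * p s) * ∑ b, (y : B → ℝ) b * g s a b := by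
      have h2 : mass β * oneShotPayoff g p x y =
          ∑ a, ∑ s, mass (μ a) * p s * ∑ b, (y : B → ℝ) b * g s a b := by
        rw [← sum_mul_sum_sum_eq_oneShotPayoff, Finset.mul_sum, Finset.sum_comm]
        refine Finset.sum_congr rfl fun s _ => ?_
        rw [Finset.mul_sum, Finset.mul_sum]
        refine Finset.sum_congr rfl fun a _ => ?_
        have hx : (x : A → ℝ) a = mass (μ a) / mass β := rfl
        simp only [hx, mul_assoc, ← Finset.mul_sum]
        field_simp
      rw [h2, ← Finset.sum_add_distrib]
      refine Finset.sum_congr rfl fun a _ => ?_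
      rw [← Finset.sum_add_distrib]
      exact Finset.sum_congr rfl fun s _ => by ring
    have h3 : ∑ a, ∑ s, (μ a s - mass (μ a) * p s) * ∑ b, (y : B → ℝ) b * g s a b ≤
        M * ∑ a, ∑ s, |μ a s - mass (μ a) * p s| := by
      rw [Finset.mul_sum]
      refine Finset.sum_le_sum fun a _ => ?_
      rw [Finset.mul_sum]
      refine Finset.sum_le_sum fun s _ => (le_abs_self _).trans ?_
      rw [abs_mul, mul_comm M]
      exact mul_le_mul_of_nonneg_left (abs_sum_simplex_mul_le y.2 fun b => hg s a b)
        (abs_nonneg _)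
    have h4 := mul_le_mul_of_nonneg_left (hy.trans (add_le_add_left (hf p hp) η)) h.le
    rw [h1]
    linarith

end BestResponse

/-! ### Unnormalized beliefs of player 2 -/

section Belief

theorem sum_weight2_mul {A B : Type*} [Fintype A] [Fintype B] (τ : Strategy2 A B) (k : ℕ)
    (H : (Fin k → A) → ℝ) :
    ∑ c : Fin k → A × B, weight2 τ k c * H (fun i => (c i).1) = ∑ α, H α := by
  induction k with
  | zero =>
    simp only [Finset.univ_unique, Finset.sum_singleton, weight2, one_mul]
    exact congrArg H (Subsingleton.elim _ _)
  | succ k ih =>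
    rw [sum_fin_succ_function, sum_fin_succ_function,
      ← ih fun α => ∑ a, H (Fin.snoc (α := fun _ => A) α a)]
    refine Finset.sum_congr rfl fun c _ => ?_
    simp only [fst_comp_snoc, weight2_snoc]
    rw [Fintype.sum_prod_type, Finset.mul_sum]
    refine Finset.sum_congr rfl fun a _ => ?_
    simp only [mul_right_comm _ _ (H _), ← Finset.mul_sum, sum_simplex_mul, mul_one]

variable {S A B : Type*} [Fintype S] [DecidableEq S] [Fintype A]

/-- Unnormalized belief on the state at stage `k` given the past actions of player 1. -/
def priorBelief (Q : Matrix S S ℝ) (p : S → ℝ) (σ : Strategy1 S A) (k : ℕ) (α : Fin k → A)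
    (s : S) : ℝ :=
  ∑ h : Fin (k + 1) → S,
    chainWeight Q p k h * weight1 σ k (Fin.init h) α * if h (Fin.last k) = s then 1 else 0

/-- Unnormalized belief on the state at stage `k` given the past actions and the action `a` of
player 1 at stage `k`. -/
def posteriorBelief (Q : Matrix S S ℝ) (p : S → ℝ) (σ : Strategy1 S A) (k : ℕ) (α : Fin k → A)
    (a : A) (s : S) : ℝ :=
  ∑ h : Fin (k + 1) → S, chainWeight Q p k h * weight1 σ k (Fin.init h) α *
    (σ k h α : A → ℝ) a * if h (Fin.last k) = s then 1 else 0

variable {Q : Matrix S S ℝ} {p : S → ℝ} (σ : Strategy1 S A) (k : ℕ) (α : Fin k → A)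

theorem priorBelief_eq_sum (s : S) :
    priorBelief Q p σ k α s = ∑ a, posteriorBelief Q p σ k α a s := by
  simp only [posteriorBelief, priorBelief]
  rw [Finset.sum_comm]
  refine Finset.sum_congr rfl fun h _ => ?_
  rw [← Finset.sum_mul, ← Finset.mul_sum, sum_simplex_mul, mul_one]

theorem sum_posteriorBelief_mul (a : A) (F : S → ℝ) :
    ∑ s, posteriorBelief Q p σ k α a s * F s = ∑ h : Fin (k + 1) → S,
      chainWeight Q p k h * weight1 σ k (Fin.init h) α * (σ k h α : A → ℝ) a *
        F (h (Fin.last k)) := by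
  simp only [posteriorBelief, Finset.sum_mul]
  rw [Finset.sum_comm]
  refine Finset.sum_congr rfl fun h _ => ?_
  simp [mul_assoc]

/-- Without normalization the Bayesian update is linear: condition on the action, then let the chain
move. -/
theorem priorBelief_snoc (a : A) (s : S) :
    priorBelief Q p σ (k + 1) (Fin.snoc (α := fun _ => A) α a) s =
      ∑ s', posteriorBelief Q p σ k α a s' * Q s' s := by
  rw [sum_posteriorBelief_mul σ k α a fun s' => Q s' s, priorBelief, sum_fin_succ_function]
  refine Finset.sum_congr rfl fun h _ => ?_
  simp only [chainWeight, weight1_snoc, Fin.init_snoc, Fin.snoc_castSucc, Fin.snoc_last]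
  simp only [mul_ite, mul_one, mul_zero, Finset.sum_ite_eq', Finset.mem_univ, if_true]
  ring

theorem posteriorBelief_nonneg (hQ : ∀ s s', 0 ≤ Q s s') (hp : ∀ s, 0 ≤ p s) (a : A) (s : S) :
    0 ≤ posteriorBelief Q p σ k α a s := by
  refine Finset.sum_nonneg fun h _ => mul_nonneg (mul_nonneg (mul_nonneg
    (chainWeight_nonneg hQ hp k h) (weight1_nonneg _ _ _ _)) ((σ k h α).2.1 a)) ?_
  split_ifs <;> norm_num

theorem priorBelief_nonneg (hQ : ∀ s s', 0 ≤ Q s s') (hp : ∀ s, 0 ≤ p s) (s : S) :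
    0 ≤ priorBelief Q p σ k α s := by
  rw [priorBelief_eq_sum]
  exact Finset.sum_nonneg fun a _ => posteriorBelief_nonneg σ k α hQ hp a s

/-- Beliefs average to the law of the state whatever player 1 reveals, because the chain is not
controlled. This supplies the barycentre for Jensen's inequality. -/
theorem sum_priorBelief (s : S) : ∑ α, priorBelief Q p σ k α s = law Q p k s := by
  induction k generalizing s with
  | zero =>
    simp only [priorBelief, Finset.univ_unique, Finset.sum_singleton, weight1, mul_one]
    have h1 := sum_chainWeight_mul Q p 0 fun s' => if s' = s then 1 else 0
    rw [h1]
    simp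
  | succ k ih =>
    rw [sum_fin_succ_function]
    simp only [priorBelief_snoc, law]
    calc ∑ α, ∑ a, ∑ s', posteriorBelief Q p σ k α a s' * Q s' s
        = ∑ α, ∑ s', priorBelief Q p σ k α s' * Q s' s := by
          refine Finset.sum_congr rfl fun α _ => ?_
          rw [Finset.sum_comm]
          refine Finset.sum_congr rfl fun s' _ => ?_
          rw [priorBelief_eq_sum, Finset.sum_mul]
      _ = ∑ s', law Q p k s' * Q s' s := by
          rw [Finset.sum_comm]
          refine Finset.sum_congr rfl fun s' _ => ?_
          rw [← Finset.sum_mul, ih]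

theorem sum_mass_priorBelief (hQ : ∀ s s', 0 ≤ Q s s') (hQ' : ∀ s, ∑ s', Q s s' = 1)
    (hp : p ∈ stdSimplex ℝ S) : ∑ α, mass (priorBelief Q p σ k α) = 1 := by
  simp only [mass]
  rw [Finset.sum_comm]
  simp only [sum_priorBelief]
  exact (law_mem hQ hQ' hp k).2

theorem sum_mass_posteriorBelief (hQ : ∀ s s', 0 ≤ Q s s') (hQ' : ∀ s, ∑ s', Q s s' = 1)
    (hp : p ∈ stdSimplex ℝ S) :
    ∑ α, ∑ a, mass (posteriorBelief Q p σ k α a) = 1 := by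
  rw [← sum_mass_priorBelief σ k hQ hQ' hp]
  refine Finset.sum_congr rfl fun α _ => ?_
  simp only [mass, priorBelief_eq_sum]
  exact Finset.sum_comm

variable [Fintype B]

/-- Player 2's own past actions sum out when the reply disregards them, leaving after each `α` the
one-stage problem treated by `exists_reply`. -/
theorem stagePayoff_reply (g : S → A → B → ℝ) (y : (k : ℕ) → (Fin k → A) → stdSimplex ℝ B) :
    stagePayoff g Q p σ (fun k c => y k fun i => (c i).1) k =
      ∑ α, ∑ a, ∑ s, posteriorBelief Q p σ k α a s * ∑ b, (y k α : B → ℝ) b * g s a b := by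
  set τ : Strategy2 A B := fun k c => y k fun i => (c i).1 with hτ
  rw [stagePayoff_eq, Finset.sum_comm, ← sum_weight2_mul τ k]
  refine Finset.sum_congr rfl fun c _ => ?_
  rw [Finset.mul_sum]
  have h1 := fun a => sum_posteriorBelief_mul (Q := Q) (p := p) σ k (fun i => (c i).1) a
    fun s => ∑ b, (y k (fun i => (c i).1) : B → ℝ) b * g s a b
  simp only [h1]
  simp only [Finset.mul_sum]
  rw [Finset.sum_comm]
  refine Finset.sum_congr rfl fun a _ => Finset.sum_congr rfl fun h _ =>
    Finset.sum_congr rfl fun b _ => ?_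
  simp only [hτ]
  ring

end Belief

/-! ### Upper bound through the discounted energy -/

section UpperBound

variable {S A B : Type*} [Fintype S] [DecidableEq S] [Fintype A]
  {M : ℝ} {Q : Matrix S S ℝ} {p : S → ℝ}

/-- Expected squared norm of the belief at stage `k`. -/
def totalEnergy (Q : Matrix S S ℝ) (p : S → ℝ) (σ : Strategy1 S A) (k : ℕ) : ℝ :=
  ∑ α, energy (priorBelief Q p σ k α)

theorem totalEnergy_nonneg (hQ : ∀ s s', 0 ≤ Q s s') (hp : ∀ s, 0 ≤ p s) (σ : Strategy1 S A)
    (k : ℕ) : 0 ≤ totalEnergy Q p σ k :=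
  Finset.sum_nonneg fun α _ => energy_nonneg (priorBelief_nonneg σ k α hQ hp)

theorem totalEnergy_le_one (hQ : ∀ s s', 0 ≤ Q s s') (hQ' : ∀ s, ∑ s', Q s s' = 1)
    (hp : p ∈ stdSimplex ℝ S) (σ : Strategy1 S A) (k : ℕ) : totalEnergy Q p σ k ≤ 1 := by
  rw [← sum_mass_priorBelief σ k hQ hQ' hp]
  exact Finset.sum_le_sum fun α _ => energy_le_mass (priorBelief_nonneg σ k α hQ hp.1)

theorem sum_energy_posteriorBelief_le (hQ : ∀ s s', 0 ≤ Q s s') (hQ' : ∀ s, ∑ s', Q s s' = 1)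
    (hp : p ∈ stdSimplex ℝ S) (σ : Strategy1 S A) (k : ℕ) :
    ∑ α, ∑ a, energy (posteriorBelief Q p σ k α a) ≤ totalEnergy Q p σ (k + 1) + 2 * drift Q := by
  have h1 : totalEnergy Q p σ (k + 1) =
      ∑ α, ∑ a, energy fun s => ∑ s', posteriorBelief Q p σ k α a s' * Q s' s := by
    rw [totalEnergy, sum_fin_succ_function]
    refine Finset.sum_congr rfl fun α _ => Finset.sum_congr rfl fun a _ => ?_
    congr 1
    ext s
    exact priorBelief_snoc σ k α a s
  have h2 : 2 * drift Q = ∑ α, ∑ a, 2 * drift Q * mass (posteriorBelief Q p σ k α a) := by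
    simp only [← Finset.mul_sum]
    rw [sum_mass_posteriorBelief σ k hQ hQ' hp, mul_one]
  rw [h1, h2, ← Finset.sum_add_distrib]
  refine Finset.sum_le_sum fun α _ => ?_
  rw [← Finset.sum_add_distrib]
  refine Finset.sum_le_sum fun a _ => ?_
  linarith [energy_transition_ge hQ hQ' (posteriorBelief_nonneg σ k α hQ hp.1 a)]

theorem sum_mass_mul_le_of_concaveOn {f : (S → ℝ) → ℝ} (hf : ConcaveOn ℝ (stdSimplex ℝ S) f)
    (hQ : ∀ s s', 0 ≤ Q s s') (hQ' : ∀ s, ∑ s', Q s s' = 1)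
    (hp : p ∈ stdSimplex ℝ S) (σ : Strategy1 S A) (k : ℕ) :
    ∑ α, mass (priorBelief Q p σ k α) *
        f (fun s => priorBelief Q p σ k α s / mass (priorBelief Q p σ k α)) ≤
      f (law Q p k) := by
  have h0 := fun α => priorBelief_nonneg (p := p) σ k α hQ hp.1
  -- On null histories the normalized belief is the zero vector, outside the simplex. Any point of
  -- the simplex can replace it there, since its weight is zero.
  let q : (Fin k → A) → S → ℝ := fun α =>
    if mass (priorBelief Q p σ k α) = 0 then p
    else fun s => priorBelief Q p σ k α s / mass (priorBelief Q p σ k α)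
  have hq : ∀ α ∈ Finset.univ, q α ∈ stdSimplex ℝ S := by
    intro α _
    simp only [q]
    split_ifs with h
    · exact hp
    · exact div_mass_mem (h0 α) ((mass_nonneg (h0 α)).lt_of_ne' h)
  have h1 := hf.le_map_sum (t := Finset.univ) (w := fun α => mass (priorBelief Q p σ k α))
    (p := q) (fun α _ => mass_nonneg (h0 α)) (sum_mass_priorBelief σ k hQ hQ' hp) hq
  have h2 : ∑ α, mass (priorBelief Q p σ k α) • q α = law Q p k := by
    ext s
    rw [← sum_priorBelief σ k s, Finset.sum_apply]
    refine Finset.sum_congr rfl fun α _ => ?_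
    simp only [q, Pi.smul_apply, smul_eq_mul]
    split_ifs with h
    · rw [h, zero_mul, eq_zero_of_mass_eq_zero (h0 α) h]
    · exact mul_div_cancel₀ _ h
  rw [h2] at h1
  refine (le_of_eq (Finset.sum_congr rfl fun α _ => ?_)).trans h1
  simp only [q, smul_eq_mul]
  split_ifs with h
  · rw [h, zero_mul, zero_mul]
  · rfl

variable [Fintype B] [Nonempty B] {g : S → A → B → ℝ}

/-- Knowing the strategy of player 1, player 2 can hold the payoff of each stage to the value of
any concave majorant of `u` at the current law, up to the increments of the energy. -/
theorem exists_reply_strategy (hM : 0 ≤ M) (hg : ∀ s a b, |g s a b| ≤ M)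
    {f : (S → ℝ) → ℝ} (hf : ConcaveOn ℝ (stdSimplex ℝ S) f)
    (hfu : ∀ q ∈ stdSimplex ℝ S, oneShotValue g q ≤ f q)
    (hQ : ∀ s s', 0 ≤ Q s s') (hQ' : ∀ s, ∑ s', Q s s' = 1)
    (hp : p ∈ stdSimplex ℝ S) (σ : Strategy1 S A) {δ : ℝ} (hδ : 0 < δ) :
    ∃ τ : Strategy2 A B, ∀ k, stagePayoff g Q p σ τ k ≤ f (law Q p k) + δ +
      M * (Fintype.card S * δ + 1 / (4 * δ) *
        (totalEnergy Q p σ (k + 1) - totalEnergy Q p σ k + 2 * drift Q)) := by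
  have h0 := fun k α => posteriorBelief_nonneg (p := p) σ k α hQ hp.1
  choose y hy using fun (k : ℕ) (α : Fin k → A) =>
    exists_reply hg hfu (h0 k α) (priorBelief_eq_sum (Q := Q) (p := p) σ k α) hδ
  refine ⟨fun k c => y k fun i => (c i).1, fun k => ?_⟩
  rw [stagePayoff_reply]
  have h1 : ∀ α, ∑ a, ∑ s, posteriorBelief Q p σ k α a s * ∑ b, (y k α : B → ℝ) b * g s a b ≤
      mass (priorBelief Q p σ k α) *
        f (fun s => priorBelief Q p σ k α s / mass (priorBelief Q p σ k α)) +
      δ * mass (priorBelief Q p σ k α) +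
      M * (Fintype.card S * δ * mass (priorBelief Q p σ k α) + 1 / (4 * δ) *
        (∑ a, energy (posteriorBelief Q p σ k α a) - energy (priorBelief Q p σ k α))) :=
    fun α => (hy k α).trans (add_le_add_right (mul_le_mul_of_nonneg_left
      (sum_abs_splitting_le (h0 k α) (priorBelief_eq_sum σ k α) hδ) hM) _)
  -- The same `δ` serves as the tolerance of the reply and as the parameter of the quadratic bound.
  refine (Finset.sum_le_sum fun α _ => h1 α).trans ?_
  rw [Finset.sum_add_distrib, Finset.sum_add_distrib, ← Finset.mul_sum, ← Finset.mul_sum,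
    Finset.sum_add_distrib, ← Finset.mul_sum, ← Finset.mul_sum, Finset.sum_sub_distrib,
    sum_mass_priorBelief σ k hQ hQ' hp, mul_one, mul_one]
  refine add_le_add (add_le_add (sum_mass_mul_le_of_concaveOn hf hQ hQ' hp σ k) le_rfl) ?_
  refine mul_le_mul_of_nonneg_left (add_le_add le_rfl
    (mul_le_mul_of_nonneg_left ?_ (by positivity))) hM
  have h2 := sum_energy_posteriorBelief_le hQ hQ' hp σ k
  change _ - totalEnergy Q p σ k ≤ _
  linarith

/-- Discounted sum of increments of a sequence with values in `[0, 1]`. -/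
theorem tsum_discount_increment_le {l : ℝ} (h₀ : 0 < l) (h₁ : l < 1) {E : ℕ → ℝ}
    (hE : ∀ k, 0 ≤ E k) (hE' : ∀ k, E k ≤ 1) :
    ∑' k, l * (1 - l) ^ k * (E (k + 1) - E k) ≤ l := by
  have hE1 : ∀ k, |E k| ≤ 1 := fun k => by rw [abs_of_nonneg (hE k)]; exact hE' k
  have h2 := tsum_discount_mul_mix h₀ h₁ (fun k => hE1 (k + 1)) hE1 1 (-1)
  -- Abel summation: with T the discounted sum of E (k + 1), that of E k equals l E 0 + (1 - l) T.
  -- The difference is l (T - E 0), at most l.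
  have h3 := (summable_discount_mul h₀ h₁ hE1).tsum_eq_zero_add
  have h4 : ∑' k, l * (1 - l) ^ (k + 1) * E (k + 1) =
      (1 - l) * ∑' k, l * (1 - l) ^ k * E (k + 1) := by
    rw [← tsum_mul_left]
    exact tsum_congr fun k => by ring
  have h5 : ∑' k, l * (1 - l) ^ k * E (k + 1) ≤ 1 :=
    (abs_le.1 (abs_tsum_discount_mul_le h₀ h₁ fun k => hE1 (k + 1))).2
  have h6 : ∀ k, 1 * E (k + 1) + -1 * E k = E (k + 1) - E k := fun k => by ring
  simp only [h6] at h2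
  rw [h2]
  rw [h4, pow_zero, mul_one] at h3
  have h7 := mul_nonneg h₀.le (hE 0)
  have h8 := mul_le_mul_of_nonneg_left h5 h₀.le
  linarith

/-- Stage errors are discounted: those independent of the stage keep their size, as the weights sum
to one, and the energy increments contribute only the factor λ_n. As the reply may depend on `σ`,
the bound concerns sup inf. -/
theorem lowerValue_gamePayoff_le [Nonempty A] {R : Matrix S S ℝ} {r : ℝ} {n : ℕ} (hM : 0 ≤ M)
    (hg : ∀ s a b, |g s a b| ≤ M) (hR : IsGenerator R) (hr : 0 < r) (hn : 1 ≤ n)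
    (hp : p ∈ stdSimplex ℝ S) {f : (S → ℝ) → ℝ} (hf : ConcaveOn ℝ (stdSimplex ℝ S) f)
    (hfu : ∀ q ∈ stdSimplex ℝ S, oneShotValue g q ≤ f q) {M' : ℝ}
    (hfM : ∀ q ∈ stdSimplex ℝ S, |f q| ≤ M') {δ : ℝ} (hδ : 0 < δ) :
    lowerValue (gamePayoff g R r n p) ≤
      ∑' k, stageDiscount r n * (1 - stageDiscount r n) ^ k *
        f (law (semigroup R (1 / (n : ℝ))) p k) +
      ((1 + M * Fintype.card S) * δ + M / (4 * δ) *
        (stageDiscount r n + 2 * drift (semigroup R (1 / (n : ℝ))))) := by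
  have hl := stageDiscount_pos hr hn
  have hl' := stageDiscount_lt_one r n
  have hQ : ∀ s s', 0 ≤ semigroup R (1 / (n : ℝ)) s s' := semigroup_nonneg hR (by positivity)
  have hQ' := semigroup_row_sum hR (1 / (n : ℝ))
  set Q := semigroup R (1 / (n : ℝ)) with hQdef
  set l := stageDiscount r n with hldef
  refine lowerValue_le (abs_gamePayoff_le hg hR hr hn hp) fun σ => ?_
  obtain ⟨τ, hτ⟩ := exists_reply_strategy hM hg hf hfu hQ hQ' hp σ hδ
  refine ⟨τ, ?_⟩
  have hE := totalEnergy_nonneg hQ hp.1 σ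
  have hE' := totalEnergy_le_one hQ hQ' hp σ
  set E := totalEnergy Q p σ with hEdef
  set c := (1 + M * Fintype.card S) * δ + M / (4 * δ) * (2 * drift Q) with hc
  have hF : ∀ k, |f (law Q p k)| ≤ M' := fun k => hfM _ (law_mem hQ hQ' hp k)
  have hD : ∀ k, |E (k + 1) - E k| ≤ 1 := fun k => abs_le.2
    ⟨by linarith [hE (k + 1), hE' k], by linarith [hE k, hE' (k + 1)]⟩
  have hG : ∀ k, |c + M / (4 * δ) * (E (k + 1) - E k)| ≤ |c| + M / (4 * δ) := by
    intro k
    refine (abs_add_le _ _).trans (add_le_add le_rfl ?_)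
    rw [abs_mul, abs_of_nonneg (by positivity : 0 ≤ M / (4 * δ))]
    exact mul_le_of_le_one_right (by positivity) (hD k)
  have hFG : ∀ k, |1 * f (law Q p k) + 1 * (c + M / (4 * δ) * (E (k + 1) - E k))| ≤
      M' + (|c| + M / (4 * δ)) := fun k => by
    rw [one_mul, one_mul]
    exact (abs_add_le _ _).trans (add_le_add (hF k) (hG k))
  have h1 : gamePayoff g R r n p σ τ ≤ ∑' k, l * (1 - l) ^ k *
      (1 * f (law Q p k) + 1 * (c + M / (4 * δ) * (E (k + 1) - E k))) := by
    refine tsum_discount_mul_le hl hl' (abs_stagePayoff_semigroup_le hg hR hp σ τ) hFG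
      fun k => (hτ k).trans (le_of_eq ?_)
    rw [hc]
    field_simp
    ring
  rw [tsum_discount_mul_mix hl hl' (M := max M' (|c| + M / (4 * δ)))
    (fun k => (hF k).trans (le_max_left _ _)) (fun k => (hG k).trans (le_max_right _ _))] at h1
  have h2 := tsum_discount_mul_mix hl hl' (F₀ := fun _ => 1) (M := 1) (fun k => by simp) hD c
    (M / (4 * δ))
  simp only [mul_one, (hasSum_discount hl hl').tsum_eq] at h2
  have h3 := mul_le_mul_of_nonneg_left (tsum_discount_increment_le hl hl' hE hE')
    (by positivity : 0 ≤ M / (4 * δ))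
  have h4 : c + M / (4 * δ) * l =
      (1 + M * Fintype.card S) * δ + M / (4 * δ) * (l + 2 * drift Q) := by
    rw [hc]
    ring
  rw [h2, one_mul, one_mul] at h1
  linarith

end UpperBound

/-! ### Comparison of discounted sums and integrals -/

section Discretization

theorem integrableOn_discount {r : ℝ} (hr : 0 < r) :
    MeasureTheory.IntegrableOn (fun t => r * Real.exp (-r * t)) (Set.Ioi 0) :=
  (integrableOn_exp_mul_Ioi (neg_lt_zero.2 hr) 0).const_mul r

theorem integrableOn_discount_mul {r : ℝ} (hr : 0 < r) {F : ℝ → ℝ}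
    (hF : ContinuousOn F (Set.Ici 0)) {M : ℝ} (hM : ∀ t, 0 ≤ t → |F t| ≤ M) :
    MeasureTheory.IntegrableOn (fun t => r * Real.exp (-r * t) * F t) (Set.Ioi 0) := by
  refine MeasureTheory.Integrable.mono' ((integrableOn_discount hr).mul_const M) ?_ ?_
  · refine ContinuousOn.aestronglyMeasurable ?_ measurableSet_Ioi
    exact ContinuousOn.mul (by fun_prop) (hF.mono Set.Ioi_subset_Ici_self)
  · refine (MeasureTheory.ae_restrict_iff' measurableSet_Ioi).2 (Eventually.of_forall fun t ht => ?_)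
    have h1 : 0 ≤ r * Real.exp (-r * t) := by positivity
    rw [Real.norm_eq_abs, abs_mul, abs_of_nonneg h1]
    exact mul_le_mul_of_nonneg_left (hM t (le_of_lt ht)) h1

theorem integral_discount (r a b : ℝ) :
    ∫ t in a..b, r * Real.exp (-r * t) = Real.exp (-r * a) - Real.exp (-r * b) := by
  have h : ∀ t ∈ Set.uIcc a b,
      HasDerivAt (fun t => -Real.exp (-r * t)) (r * Real.exp (-r * t)) t := by
    intro t _
    exact (((hasDerivAt_id t).const_mul (-r)).exp).neg.congr_deriv (by simp only [id_eq]; ring)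
  rw [intervalIntegral.integral_eq_sub_of_hasDerivAt h
    ((by fun_prop : Continuous fun t => r * Real.exp (-r * t)).intervalIntegrable a b)]
  ring

/-- Thanks to the choice of λ_n, stage weights are exact integrals of the continuous discount, so
replacing the sum by the integral creates no error from the weights. -/
theorem exp_sub_exp_eq_discount (r : ℝ) {n : ℕ} (hn : 1 ≤ n) (k : ℕ) :
    Real.exp (-r * (k / n)) - Real.exp (-r * ((k + 1 : ℕ) / n)) =
      stageDiscount r n * (1 - stageDiscount r n) ^ k := by
  have hn' : (n : ℝ) ≠ 0 := by exact_mod_cast (by omega : n ≠ 0)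
  rw [one_sub_stageDiscount, ← Real.exp_nat_mul, stageDiscount, sub_mul, one_mul, ← Real.exp_add]
  congr 2
  · field_simp
  · push_cast
    field_simp
    ring

/-- The discounted integral of a function that oscillates by at most `ω` between consecutive
multiples of `1 / n` is close to its discounted sum. -/
theorem abs_integral_sub_tsum_le {r : ℝ} (hr : 0 < r) {n : ℕ} (hn : 1 ≤ n) {F : ℝ → ℝ}
    (hF : ContinuousOn F (Set.Ici 0)) {M : ℝ} (hM : ∀ t, 0 ≤ t → |F t| ≤ M) {ω : ℝ}
    (hω : ∀ (k : ℕ) (t : ℝ), (k : ℝ) / n ≤ t → t ≤ (k + 1 : ℕ) / n → |F t - F (k / n)| ≤ ω) :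
    |(∫ t in Set.Ioi (0 : ℝ), r * Real.exp (-r * t) * F t) -
      ∑' k : ℕ, stageDiscount r n * (1 - stageDiscount r n) ^ k * F (k / n)| ≤ ω := by
  have hn' : (0 : ℝ) < n := by exact_mod_cast hn
  have hl := stageDiscount_pos hr hn
  have hl' := stageDiscount_lt_one r n
  have hint := integrableOn_discount_mul hr hF hM
  have hω0 : 0 ≤ ω := (abs_nonneg _).trans (hω 0 (((0 : ℕ) : ℝ) / n) le_rfl (by
    push_cast; gcongr; norm_num))
  have hpos : ∀ k : ℕ, (0 : ℝ) ≤ k / n := fun k => by positivity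
  have hstep : ∀ k : ℕ, (k : ℝ) / n ≤ (k + 1 : ℕ) / n := fun k => by
    push_cast
    gcongr
    linarith
  have hii : ∀ k : ℕ, IntervalIntegrable (fun t => r * Real.exp (-r * t) * F t)
      MeasureTheory.volume (k / n) ((k + 1 : ℕ) / n) := fun k =>
    (intervalIntegrable_iff_integrableOn_Ioc_of_le (hstep k)).2
      (hint.mono_set fun t ht => (hpos k).trans_lt ht.1)
  have hlim : Tendsto (fun N : ℕ => ∫ t in (0 : ℝ)..(N / n : ℝ), r * Real.exp (-r * t) * F t) atTop
      (𝓝 (∫ t in Set.Ioi (0 : ℝ), r * Real.exp (-r * t) * F t)) :=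
    MeasureTheory.intervalIntegral_tendsto_integral_Ioi 0 hint
      (tendsto_natCast_atTop_atTop.atTop_div_const hn')
  have hsum := (summable_discount_mul hl hl' (F := fun k : ℕ => F (k / n))
    fun k => hM _ (hpos k)).hasSum.tendsto_sum_nat
  -- It suffices to compare the integral over [0, N/n] with the first N terms and let N tend to
  -- infinity.
  refine le_of_tendsto (hlim.sub hsum).abs (Eventually.of_forall fun N => ?_)
  have h1 : ∫ t in (0 : ℝ)..(N / n : ℝ), r * Real.exp (-r * t) * F t =
      ∑ k ∈ Finset.range N,
        ∫ t in (k / n : ℝ)..((k + 1 : ℕ) / n : ℝ), r * Real.exp (-r * t) * F t := by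
    rw [intervalIntegral.sum_integral_adjacent_intervals (a := fun k : ℕ => (k / n : ℝ))
      fun k _ => hii k]
    simp
  have h2 : ∀ k : ℕ, |(∫ t in (k / n : ℝ)..((k + 1 : ℕ) / n : ℝ), r * Real.exp (-r * t) * F t) -
      stageDiscount r n * (1 - stageDiscount r n) ^ k * F (k / n)| ≤
      stageDiscount r n * (1 - stageDiscount r n) ^ k * ω := by
    intro k
    have hc : ∀ x : ℝ, IntervalIntegrable (fun t => r * Real.exp (-r * t) * x)
        MeasureTheory.volume (k / n) ((k + 1 : ℕ) / n) := fun x =>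
      (by fun_prop : Continuous fun t => r * Real.exp (-r * t) * x).intervalIntegrable _ _
    have hx : ∀ x : ℝ, ∫ t in (k / n : ℝ)..((k + 1 : ℕ) / n : ℝ), r * Real.exp (-r * t) * x =
        stageDiscount r n * (1 - stageDiscount r n) ^ k * x := fun x => by
      rw [intervalIntegral.integral_mul_const, integral_discount, exp_sub_exp_eq_discount r hn]
    rw [← hx, ← hx, ← intervalIntegral.integral_sub (hii k) (hc _),
      ← Real.norm_eq_abs]
    refine intervalIntegral.norm_integral_le_of_norm_le (hstep k)
      (Eventually.of_forall fun t ht => ?_) (hc ω)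
    have h3 : 0 ≤ r * Real.exp (-r * t) := by positivity
    rw [← mul_sub, Real.norm_eq_abs, abs_mul, abs_of_nonneg h3]
    exact mul_le_mul_of_nonneg_left (hω k t ht.1.le ht.2) h3
  rw [h1, ← Finset.sum_sub_distrib]
  calc _ ≤ ∑ k ∈ Finset.range N, stageDiscount r n * (1 - stageDiscount r n) ^ k * ω :=
        (Finset.abs_sum_le_sum_abs _ _).trans (Finset.sum_le_sum fun k _ => h2 k)
    _ ≤ 1 * ω := by
        rw [← Finset.sum_mul]
        refine mul_le_mul_of_nonneg_right ?_ hω0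
        exact sum_le_hasSum _ (fun k _ => mul_nonneg hl.le (pow_nonneg (by linarith) k))
          (hasSum_discount hl hl')
    _ = ω := one_mul ω

end Discretization

/-! ### Passage to the limit -/

section Limit

variable {S A B : Type*} [Fintype S] [DecidableEq S] [Fintype A] [Fintype B]
  {g : S → A → B → ℝ} {R : Matrix S S ℝ} {r : ℝ}

theorem oneShotValue_le_sum_of_convex (hu : ConvexOn ℝ (stdSimplex ℝ S) (oneShotValue g))
    {q : S → ℝ} (hq : q ∈ stdSimplex ℝ S) :
    oneShotValue g q ≤ ∑ s, q s * oneShotValue g (Pi.single s 1) := by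
  have h1 := hu.map_sum_le (t := Finset.univ) (w := q) (p := fun s => Pi.single s (1 : ℝ))
    (fun s _ => hq.1 s) hq.2 fun s _ => single_mem_stdSimplex ℝ s
  rwa [← pi_eq_sum_univ' q] at h1

/-- Restarting the flow at time `s` reduces the increment to one from time zero. The bound does not
depend on `p`, whence uniform convergence. -/
theorem abs_comp_beliefFlow_sub_le (hR : IsGenerator R) {f : (S → ℝ) → ℝ} {L : ℝ} (hL : 0 ≤ L)
    (hf : ∀ p ∈ stdSimplex ℝ S, ∀ q ∈ stdSimplex ℝ S, |f p - f q| ≤ L * ∑ s, |p s - q s|)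
    {p : S → ℝ} (hp : p ∈ stdSimplex ℝ S) {s t : ℝ} (hs : 0 ≤ s) (hst : s ≤ t) :
    |f (beliefFlow R p t) - f (beliefFlow R p s)| ≤ L * drift (semigroup R (t - s)) := by
  refine (hf _ (beliefFlow_mem hR hp (hs.trans hst)) _ (beliefFlow_mem hR hp hs)).trans
    (mul_le_mul_of_nonneg_left ?_ hL)
  have h1 : beliefFlow R p t = beliefFlow R (beliefFlow R p s) (t - s) := by
    rw [← beliefFlow_add, add_sub_cancel]
  rw [h1]
  exact sum_abs_beliefFlow_sub_le R (beliefFlow_mem hR hp hs) _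

theorem continuousOn_comp_beliefFlow (hR : IsGenerator R) {f : (S → ℝ) → ℝ} {L : ℝ}
    (hf : ∀ p ∈ stdSimplex ℝ S, ∀ q ∈ stdSimplex ℝ S, |f p - f q| ≤ L * ∑ s, |p s - q s|)
    {p : S → ℝ} (hp : p ∈ stdSimplex ℝ S) :
    ContinuousOn (fun t => f (beliefFlow R p t)) (Set.Ici 0) := by
  intro t ht
  have h1 : Continuous fun t' => L * ∑ s, |beliefFlow R p t' s - beliefFlow R p t s| :=
    continuous_const.mul (continuous_finsetSum _ fun s _ =>
      (((continuous_apply s).comp (continuous_beliefFlow R p)).sub continuous_const).abs)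
  have h2 := (h1.tendsto t).mono_left (nhdsWithin_le_nhds (s := Set.Ici (0 : ℝ)))
  simp only [sub_self, abs_zero, Finset.sum_const_zero, mul_zero] at h2
  refine tendsto_iff_dist_tendsto_zero.2 (squeeze_zero' (Eventually.of_forall fun _ => dist_nonneg)
    ?_ h2)
  filter_upwards [self_mem_nhdsWithin] with t' ht'
  exact hf _ (beliefFlow_mem hR hp ht') _ (beliefFlow_mem hR hp ht)

theorem tendsto_stageDiscount (r : ℝ) : Tendsto (fun n => stageDiscount r n) atTop (𝓝 0) := by
  have h1 : Tendsto (fun n : ℕ => 1 - Real.exp (-r / n)) atTop (𝓝 (1 - Real.exp 0)) :=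
    tendsto_const_nhds.sub ((Real.continuous_exp.tendsto 0).comp
      (tendsto_const_nhds.div_atTop tendsto_natCast_atTop_atTop))
  simpa [stageDiscount] using h1

variable [Nonempty A] [Nonempty B]

/-- If player 1 guarantees in every game the discounted average of a concave majorant `f` of `u`
along the flow of laws, then the limit value is the integral of `f` along this flow. -/
theorem isLimitValue_of_concave_majorant (hR : IsGenerator R) (hr : 0 < r) {f : (S → ℝ) → ℝ}
    (hf : ConcaveOn ℝ (stdSimplex ℝ S) f) (hfu : ∀ q ∈ stdSimplex ℝ S, oneShotValue g q ≤ f q)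
    {M : ℝ} (hfM : ∀ q ∈ stdSimplex ℝ S, |f q| ≤ M) {L : ℝ} (hL : 0 ≤ L)
    (hfL : ∀ p ∈ stdSimplex ℝ S, ∀ q ∈ stdSimplex ℝ S, |f p - f q| ≤ L * ∑ s, |p s - q s|)
    (hlow : ∀ n : ℕ, ∀ p ∈ stdSimplex ℝ S, ∀ ε > 0, ∃ σ : Strategy1 S A,
      ∀ (τ : Strategy2 A B) k, f (law (semigroup R (1 / (n : ℝ))) p k) - ε ≤
        stagePayoff g (semigroup R (1 / (n : ℝ))) p σ τ k) :
    IsLimitValue g R r fun p =>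
      ∫ t in Set.Ioi (0 : ℝ), r * Real.exp (-r * t) * f (beliefFlow R p t) := by
  obtain ⟨G, hG, hg⟩ := exists_payoff_bound g
  refine ⟨fun n p => lowerValue (gamePayoff g R r n p),
    fun n hn p hp => isValue_gamePayoff g hR hr hn hp, ?_⟩
  rw [Metric.tendstoUniformlyOn_iff]
  intro ε hε
  have hK : 0 < 1 + G * Fintype.card S := by positivity
  -- Chosen before `n`, so that the part of the upper bound that does not vanish with `n` equals
  -- ε/4. The vanishing part and the oscillation of `f` within a stage take ε/4 each.
  set δ := ε / (4 * (1 + G * Fintype.card S)) with hδdef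
  have hδ : 0 < δ := by positivity
  have hKδ : (1 + G * Fintype.card S) * δ = ε / 4 := by
    rw [hδdef]
    field_simp
  have hinv : Tendsto (fun n : ℕ => 1 / (n : ℝ)) atTop (𝓝 0) := tendsto_one_div_atTop_nhds_zero_nat
  have hdrift0 : Tendsto (fun t => drift (semigroup R t)) (𝓝 0) (𝓝 0) := by
    simpa [drift_semigroup_zero] using (continuous_drift_semigroup R).tendsto 0
  have herr : Tendsto (fun n : ℕ => G / (4 * δ) *
      (stageDiscount r n + 2 * drift (semigroup R (1 / (n : ℝ))))) atTop (𝓝 0) := by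
    simpa using (((tendsto_stageDiscount r).add
      ((hdrift0.comp hinv).const_mul 2)).const_mul (G / (4 * δ)))
  have hosc : ∀ᶠ t in 𝓝 (0 : ℝ), L * drift (semigroup R t) < ε / 4 := by
    have h1 := hdrift0.const_mul L
    rw [mul_zero] at h1
    exact h1.eventually_lt_const (by positivity)
  obtain ⟨ρ, hρ, hball⟩ := Metric.eventually_nhds_iff.1 hosc
  filter_upwards [eventually_ge_atTop 1, herr.eventually_lt_const (by positivity : 0 < ε / 4),
    hinv.eventually_lt_const hρ] with n hn herr_n hn_small p hp
  have hn' : (0 : ℝ) < n := by exact_mod_cast hn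
  have hlaw : ∀ k, law (semigroup R (1 / (n : ℝ))) p k = beliefFlow R p (k / n) := fun k => by
    rw [law_semigroup, mul_one_div]
  have hbound : ∀ t, 0 ≤ t → |f (beliefFlow R p t)| ≤ M := fun t ht =>
    hfM _ (beliefFlow_mem hR hp ht)
  have h1 := tsum_discount_le_lowerValue hg hR hr hn hp
    (F := fun k => f (law (semigroup R (1 / (n : ℝ))) p k)) (M' := M)
    (fun k => by rw [hlaw]; exact hbound _ (by positivity)) (hlow n p hp)
  have h2 := lowerValue_gamePayoff_le hG hg hR hr hn hp hf hfu hfM hδ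
  have h3 := abs_integral_sub_tsum_le hr hn (continuousOn_comp_beliefFlow hR hfL hp) hbound
    (ω := ε / 4) fun k t hkt htk => by
      refine (abs_comp_beliefFlow_sub_le hR hL hfL hp (by positivity) hkt).trans (hball ?_).le
      rw [Real.dist_eq, sub_zero, abs_of_nonneg (sub_nonneg.2 hkt)]
      refine lt_of_le_of_lt ?_ hn_small
      have h4 : ((k + 1 : ℕ) : ℝ) / n = k / n + 1 / n := by
        push_cast
        ring
      linarith
  simp only [hlaw] at h1 h2
  rw [Real.dist_eq, abs_lt]
  obtain ⟨h5, h6⟩ := abs_le.1 h3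
  constructor <;> linarith

theorem isLimitValue_of_concave (hR : IsGenerator R) (hr : 0 < r)
    (hu : ConcaveOn ℝ (stdSimplex ℝ S) (oneShotValue g)) :
    IsLimitValue g R r fun p =>
      ∫ t in Set.Ioi (0 : ℝ), r * Real.exp (-r * t) * oneShotValue g (beliefFlow R p t) := by
  obtain ⟨M, hM, hg⟩ := exists_payoff_bound g
  exact isLimitValue_of_concave_majorant hR hr hu (fun q _ => le_rfl)
    (fun q hq => abs_oneShotValue_le hg hq) hM (fun p hp q hq => abs_oneShotValue_sub_le hg hp hq)
    fun n p hp ε hε => exists_nonrevealing_strategy hg (semigroup_nonneg hR (by positivity))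
      (semigroup_row_sum hR _) hp hε

/-- By convexity `u` lies below the linear interpolation of its vertex values. Being linear, this
majorant is concave, and player 1 attains it by using the current state. -/
theorem isLimitValue_of_convex (hR : IsGenerator R) (hr : 0 < r)
    (hu : ConvexOn ℝ (stdSimplex ℝ S) (oneShotValue g)) :
    IsLimitValue g R r fun p =>
      ∑ s, oneShotValue g (Pi.single s 1) *
        ∫ t in Set.Ioi (0 : ℝ), r * Real.exp (-r * t) * beliefFlow R p t s := by
  obtain ⟨M, hM, hg⟩ := exists_payoff_bound g
  have hvert : ∀ s : S, |oneShotValue g (Pi.single s 1)| ≤ M := fun s =>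
    abs_oneShotValue_le hg (single_mem_stdSimplex ℝ s)
  have hlin : ConcaveOn ℝ (stdSimplex ℝ S)
      fun p : S → ℝ => ∑ s, p s * oneShotValue g (Pi.single s 1) := by
    refine ⟨convex_stdSimplex ℝ S, fun p _ q _ a b _ _ _ => le_of_eq ?_⟩
    simp only [smul_eq_mul, Finset.mul_sum, ← Finset.sum_add_distrib, Pi.add_apply, Pi.smul_apply]
    exact Finset.sum_congr rfl fun s _ => by ring
  obtain ⟨w, hw, hlim⟩ := isLimitValue_of_concave_majorant hR hr hlin
    (fun q hq => oneShotValue_le_sum_of_convex hu hq)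
    (fun q hq => abs_sum_simplex_mul_le hq hvert) hM
    (fun p _ q _ => by
      rw [← Finset.sum_sub_distrib, Finset.mul_sum]
      refine (Finset.abs_sum_le_sum_abs _ _).trans (Finset.sum_le_sum fun s _ => ?_)
      rw [← sub_mul, abs_mul, mul_comm]
      exact mul_le_mul_of_nonneg_right (hvert s) (abs_nonneg _))
    fun n p hp ε hε => exists_revealing_strategy hg (semigroup_nonneg hR (by positivity))
      (semigroup_row_sum hR _) hp hε
  -- It remains to exchange the finite sum over states with the integral.
  refine ⟨w, hw, hlim.congr_right fun p hp => ?_⟩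
  have hint : ∀ s, MeasureTheory.IntegrableOn
      (fun t => r * Real.exp (-r * t) * beliefFlow R p t s) (Set.Ioi 0) := fun s => by
    refine integrableOn_discount_mul hr (M := 1)
      ((continuous_apply s).comp (continuous_beliefFlow R p)).continuousOn fun t ht => ?_
    have h1 := beliefFlow_mem hR hp ht
    rw [abs_of_nonneg (h1.1 s), ← h1.2]
    exact Finset.single_le_sum (fun j _ => h1.1 j) (Finset.mem_univ s)
  simp only
  simp only [← MeasureTheory.integral_const_mul]
  rw [← MeasureTheory.integral_finsetSum _ fun s _ => (hint s).const_mul _]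
  refine MeasureTheory.integral_congr_ae (Eventually.of_forall fun t => ?_)
  simp only [Finset.mul_sum]
  exact Finset.sum_congr rfl fun s _ => by ring

end Limit

end MarkovGame

end

theorem mainTheorem7 {S A B : Type*} [Fintype S] [DecidableEq S] [Fintype A] [Nonempty A]
    [Fintype B] [Nonempty B] (g : S → A → B → ℝ) (R : Matrix S S ℝ)
    (hR : MarkovGame.IsGenerator R) (r : ℝ) (hr : 0 < r) :
    (ConcaveOn ℝ (stdSimplex ℝ S) (MarkovGame.oneShotValue g) →
      MarkovGame.IsLimitValue g R r (fun p =>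
        ∫ t in Set.Ioi (0 : ℝ), r * Real.exp (-r * t) *
          MarkovGame.oneShotValue g (MarkovGame.beliefFlow R p t))) ∧
    (ConvexOn ℝ (stdSimplex ℝ S) (MarkovGame.oneShotValue g) →
      MarkovGame.IsLimitValue g R r (fun p =>
        ∑ s, MarkovGame.oneShotValue g (Pi.single s 1) *
          ∫ t in Set.Ioi (0 : ℝ), r * Real.exp (-r * t) * MarkovGame.beliefFlow R p t s)) := by
  exact ⟨MarkovGame.isLimitValue_of_concave hR hr, MarkovGame.isLimitValue_of_convex hR hr⟩
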